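/- Let $\mathbb T=\mathbb R/2\pi\mathbb Z$ and let $S=\mathbb T\times[-\pi,\pi]$ be the strip, periodic in $x_1$. Let $C^\infty(S)$ be the real functions on $S$ that are smooth up to the boundary. A global smooth solution of the incompressible porous media (IPM) equation in $S$ is a density $\rho$ and a velocity $u=(u_1,u_2)$, both $C^\infty$ on $S\times[0,\infty)$, together with a pressure $p$ such that $p(\cdot,t)\in C^\infty(S)$ for each $t\ge 0$, satisfying $$\partial_t\rho+(u\cdot\nabla)\rho=0,\qquad \nabla\cdot u=0,\qquad u+\nabla p=-(0,\rho)\qquad\text{in } S\times[0,\infty),$$ and $u_2=0$ on $x_2=\pm\pi$. A function $\rho_s\in C^\infty(S)$ is a stationary solution if $\rho(x,t)=\rho_s(x)$ is the density of such a solution. For $p\in\mathbb Z$ and integers $q\ge1$ let $\omega_{p,q}(x)=\frac{1}{\sqrt2\,\pi}e^{ipx_1}b_q(x_2)$, where $b_q(x_2)=\cos(qx_2/2)$ for $q$ odd and $b_q(x_2)=\sin(qx_2/2)$ for $q$ even. These are the $L^2(S)$-orthonormal eigenfunctions of $-\Delta$ on $S$ with zero boundary condition, with eigenvalues $\lambda_{p,q}=p^2+q^2/4$.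 For $s\in\mathbb R$ and $f\in C^\infty(S)$ define, with values in $[0,\infty]$, $$\|f\|_{\dot H^s(S)}^2=\sum_{p\in\mathbb Z}\sum_{q\ge1}\lambda_{p,q}^{\,s}\Big|\int_S f\,\overline{\omega_{p,q}}\,dx\Big|^2,\qquad \|f\|_{H^s(S)}^2=\|f\|_{\dot H^s(S)}^2+\|f\|_{L^2(S)}^2 .$$ **Theorem.** Let $\rho_s\in C^\infty(S)$ be any stationary solution. For any $\epsilon,\gamma>0$ there exists $\rho_0\in C^\infty(S)$ with $$\|\rho_0-\rho_s\|_{H^{2-\gamma}(S)}\le\epsilon$$ such that every global smooth solution with $\rho(\cdot,0)=\rho_0$ satisfies $$\limsup_{t\to\infty}t^{-s/2}\,\|\rho(t)-\rho_s\|_{\dot H^{s+1}(S)}=\infty\qquad\text{for all } s>0 .$$ -/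

import Mathlib

open Set MeasureTheory Filter
open scoped ContDiff ENNReal

noncomputable section

namespace IPM

/-- The strip `S = 𝕋 × [-π, π]`, unrolled in the first variable. Functions on `S` are functions
on `ℝ × ℝ` that are `2π`-periodic in the first variable; only their values on this set matter. -/
def strip : Set (ℝ × ℝ) := univ ×ˢ Icc (-Real.pi) Real.pi

/-- A fundamental cell of the strip, over which integrals on `S` are taken. -/
def cell : Set (ℝ × ℝ) := Icc (-Real.pi) Real.pi ×ˢ Icc (-Real.pi) Real.pi

/-- `2π`-periodicity in the first variable. -/
def PeriodicFst {F : Type*} (f : ℝ × ℝ → F) : Prop :=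
  ∀ x ∈ strip, f (x.1 + 2 * Real.pi, x.2) = f x

/-- The class `C^∞(S)`: periodic, and smooth up to the boundary. -/
structure SmoothOnStrip (f : ℝ × ℝ → ℝ) : Prop where
  smooth : ContDiffOn ℝ ∞ f strip
  periodic : PeriodicFst f

/-- `∂f/∂x₁` on the strip. -/
def d1 (f : ℝ × ℝ → ℝ) (x : ℝ × ℝ) : ℝ := fderivWithin ℝ f strip x (1, 0)

/-- `∂f/∂x₂` on the strip (one-sided on the boundary). -/
def d2 (f : ℝ × ℝ → ℝ) (x : ℝ × ℝ) : ℝ := fderivWithin ℝ f strip x (0, 1)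

/-- `(ρ, u, p)` is a smooth solution on `S × [0, ∞)` of the incompressible porous media equation
`∂ₜρ + (u · ∇)ρ = 0`, `∇ · u = 0`, `u + ∇p = -(0, ρ)`, with `u · n = 0` on `∂S`.
The density and velocity are smooth in space-time; the pressure, which is only determined up to a
function of time, is smooth in space. All three are functions on `S`, so periodic in `x₁`. -/
structure IsGlobalSmoothSolution (ρ : ℝ → ℝ × ℝ → ℝ) (u : ℝ → ℝ × ℝ → ℝ × ℝ)
    (p : ℝ → ℝ × ℝ → ℝ) : Prop where
  smooth_density : ContDiffOn ℝ ∞ (fun z : ℝ × (ℝ × ℝ) => ρ z.1 z.2) (Ici 0 ×ˢ strip)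
  periodic_density : ∀ t, 0 ≤ t → PeriodicFst (ρ t)
  smooth_velocity : ContDiffOn ℝ ∞ (fun z : ℝ × (ℝ × ℝ) => u z.1 z.2) (Ici 0 ×ˢ strip)
  periodic_velocity : ∀ t, 0 ≤ t → PeriodicFst (u t)
  smooth_pressure : ∀ t, 0 ≤ t → SmoothOnStrip (p t)
  transport : ∀ t, 0 ≤ t → ∀ x ∈ strip,
    derivWithin (fun τ => ρ τ x) (Ici 0) t
      + ((u t x).1 * d1 (ρ t) x + (u t x).2 * d2 (ρ t) x) = 0
  incompressible : ∀ t, 0 ≤ t → ∀ x ∈ strip,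
    d1 (fun y => (u t y).1) x + d2 (fun y => (u t y).2) x = 0
  darcy_fst : ∀ t, 0 ≤ t → ∀ x ∈ strip, (u t x).1 + d1 (p t) x = 0
  darcy_snd : ∀ t, 0 ≤ t → ∀ x ∈ strip, (u t x).2 + d2 (p t) x = -ρ t x
  no_flow : ∀ t, 0 ≤ t → ∀ a : ℝ,
    (u t (a, Real.pi)).2 = 0 ∧ (u t (a, -Real.pi)).2 = 0

/-- `ρs ∈ C^∞(S)` is a stationary solution: constant in time, it solves the equation. -/
def IsStationarySolution (ρs : ℝ × ℝ → ℝ) : Prop :=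
  ∃ u p, IsGlobalSmoothSolution (fun _ => ρs) u p

/-- The second factor of the Dirichlet eigenfunctions: `cos (q y / 2)` for odd `q` and
`sin (q y / 2)` for even `q`. -/
def eigenfactor (q : ℕ) (y : ℝ) : ℝ :=
  if Odd q then Real.cos (q * y / 2) else Real.sin (q * y / 2)

/-- The eigenfunctions `ω_{p,q}` (`p ∈ ℤ`, `q ≥ 1`) of `-Δ` on `S` with zero boundary condition,
normalised to be orthonormal in `L²(S)`. -/
def eigenfunction (p : ℤ) (q : ℕ) (x : ℝ × ℝ) : ℂ :=
  Complex.exp (p * x.1 * Complex.I) * (eigenfactor q x.2 : ℂ) / (Real.sqrt 2 * Real.pi : ℝ)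

/-- The eigenvalue of `-Δ` that belongs to `ω_{p,q}`. -/
def eigenvalue (p : ℤ) (q : ℕ) : ℝ := (p : ℝ) ^ 2 + (q : ℝ) ^ 2 / 4

/-- The coefficient `∫_S f conj(ω_{p,q})` of `f` in the eigenfunction expansion. -/
def coeff (f : ℝ × ℝ → ℝ) (p : ℤ) (q : ℕ) : ℂ :=
  ∫ x in cell, (f x : ℂ) * (starRingEnd ℂ) (eigenfunction p q x)

/-- The homogeneous norm `‖f‖_{Ḣ^s(S)} = (∫_S f (-Δ_S)^s f)^{1/2}`, through the eigenfunction
expansion and with values in `[0, ∞]`. The sum runs over `p ∈ ℤ` and `q = n + 1 ≥ 1`. -/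
def homSobolevNorm (s : ℝ) (f : ℝ × ℝ → ℝ) : ℝ≥0∞ :=
  (∑' k : ℤ × ℕ, ENNReal.ofReal (eigenvalue k.1 (k.2 + 1) ^ s)
    * ENNReal.ofReal (‖coeff f k.1 (k.2 + 1)‖ ^ 2)) ^ (1 / 2 : ℝ)

/-- The norm `‖f‖_{H^s(S)} = (‖f‖_{Ḣ^s(S)}² + ‖f‖_{L²(S)}²)^{1/2}`, with values in `[0, ∞]`. -/
def sobolevNorm (s : ℝ) (f : ℝ × ℝ → ℝ) : ℝ≥0∞ :=
  (homSobolevNorm s f ^ 2 + eLpNorm f 2 (volume.restrict cell) ^ 2) ^ (1 / 2 : ℝ)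

end IPM

end

/-!
# Instability of stratified states for the porous media equation

A stationary solution dissipates no potential energy, hence is at rest, and its density is a
function of `x₂` alone (`IsStationarySolution.eq_of_mem_strip`). Near a maximum of this function a
bump `β` of height and width of order `δ` is added. Its slope is of order one, so `Δβ` is bounded in
`L²` while `β` tends to zero there, and interpolation makes `β` small in `H^{2-γ}`
(`IsStationarySolution.exists_perturbation`). The new density exceeds the maximum `M` of the old one
inside a bubble that does not reach the line `x₁ = π`.

The bubble cannot be stretched around the strip. The back-to-labels map of the flow, lifted to
`ℝ × [-π, π]`, moves points a bounded distance, so it maps each horizontal line onto a curve that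
crosses `x₁ = π`; at every time the density is therefore at most `M` somewhere on every
horizontal line (`IsGlobalSmoothSolution.exists_density_eq_initial`). On the other hand
`∫ (ρ - M)₊²` is conserved and positive. Poincaré's inequality on horizontal lines then bounds
`‖∂₁ρ(t)‖_{L²}` from below for all times (`IsGlobalSmoothSolution.exists_lower_bound`).

Finally, the potential energy `∫ ρ x₂` is bounded and has derivative `-‖u‖²`, so `‖u(t)‖²` is not
bounded below by a multiple of `1 / t`. By Darcy's law `curl u = -∂₁ρ`, so that `‖u‖` dominates the
`Ḣ⁻¹` norm of `∂₁ρ`. The `L²` norm of `∂₁ρ` lies between its `Ḣ⁻¹` norm and its `Ḣˢ` norm, and the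
latter is at most `‖ρ - ρs‖_{Ḣ^{s+1}}` because `ρs` has no modes with `p ≠ 0`
(`IsGlobalSmoothSolution.interpolation`). Growth of this norm of order `t^{s/2}` or less would
thus force `‖u(t)‖² ≥ c / t` for all large `t`, which is impossible
(`IsGlobalSmoothSolution.limsup_eq_top`). The spectral inequalities rest on Parseval's identity for
the Dirichlet eigenfunctions and Bessel's inequality for their Neumann counterparts, both reduced to
one-dimensional Fourier series (`tsum_sq_coeff`, `tsum_sq_cocoeff_le`).
-/

noncomputable section

namespace IPM

/-! ### Calculus on the strip -/

lemma neg_pi_lt_pi : -Real.pi < Real.pi := by linarith [Real.pi_pos]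

lemma uniqueDiffOn_strip : UniqueDiffOn ℝ strip :=
  uniqueDiffOn_univ.prod (uniqueDiffOn_Icc neg_pi_lt_pi)

lemma cell_subset_strip : cell ⊆ strip := prod_mono (subset_univ _) subset_rfl

lemma isCompact_cell : IsCompact cell := isCompact_Icc.prod isCompact_Icc

lemma measurableSet_cell : MeasurableSet cell := isCompact_cell.measurableSet

lemma mem_strip {x : ℝ × ℝ} : x ∈ strip ↔ x.2 ∈ Icc (-Real.pi) Real.pi := by simp [strip]

lemma mk_mem_strip {a b : ℝ} (hb : b ∈ Icc (-Real.pi) Real.pi) : (a, b) ∈ strip := mem_strip.2 hb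

lemma hasDerivAt_d1 {f : ℝ × ℝ → ℝ} (hf : ContDiffOn ℝ ∞ f strip) {x : ℝ × ℝ} (hx : x ∈ strip) :
    HasDerivAt (fun a => f (a, x.2)) (d1 f x) x.1 := by
  have h := (hf.differentiableOn (by simp) x hx).hasFDerivWithinAt
  have h2 : HasDerivAt (fun a : ℝ => (a, x.2)) ((1 : ℝ), (0 : ℝ)) x.1 :=
    (hasDerivAt_id x.1).prodMk (hasDerivAt_const _ _)
  exact h.comp_hasDerivAt x.1 h2 (Eventually.of_forall fun a => mk_mem_strip (mem_strip.1 hx))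

lemma hasDerivWithinAt_d2 {f : ℝ × ℝ → ℝ} (hf : ContDiffOn ℝ ∞ f strip) {x : ℝ × ℝ}
    (hx : x ∈ strip) :
    HasDerivWithinAt (fun b => f (x.1, b)) (d2 f x) (Icc (-Real.pi) Real.pi) x.2 := by
  have h := (hf.differentiableOn (by simp) x hx).hasFDerivWithinAt
  have h2 : HasDerivWithinAt (fun b : ℝ => (x.1, b)) ((0 : ℝ), (1 : ℝ))
      (Icc (-Real.pi) Real.pi) x.2 :=
    (hasDerivWithinAt_const _ _ _).prodMk (hasDerivWithinAt_id _ _)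
  exact h.comp_hasDerivWithinAt x.2 h2 fun b hb => mk_mem_strip hb

lemma continuousOn_d1 {f : ℝ × ℝ → ℝ} (hf : ContDiffOn ℝ ∞ f strip) : ContinuousOn (d1 f) strip :=
  (hf.continuousOn_fderivWithin uniqueDiffOn_strip (by simp)).clm_apply continuousOn_const

lemma continuousOn_d2 {f : ℝ × ℝ → ℝ} (hf : ContDiffOn ℝ ∞ f strip) : ContinuousOn (d2 f) strip :=
  (hf.continuousOn_fderivWithin uniqueDiffOn_strip (by simp)).clm_apply continuousOn_const

section Integration

variable {E : Type*} [NormedAddCommGroup E]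

lemma integrableOn_cell {f : ℝ × ℝ → E} (hf : ContinuousOn f cell) : IntegrableOn f cell :=
  hf.integrableOn_compact isCompact_cell

lemma continuousOn_slice_fst {f : ℝ × ℝ → E} (hf : ContinuousOn f cell) {b : ℝ}
    (hb : b ∈ Icc (-Real.pi) Real.pi) :
    ContinuousOn (fun a => f (a, b)) (Icc (-Real.pi) Real.pi) :=
  hf.comp (by fun_prop) fun _ ha => ⟨ha, hb⟩

lemma continuousOn_slice_snd {f : ℝ × ℝ → E} (hf : ContinuousOn f cell) {a : ℝ}
    (ha : a ∈ Icc (-Real.pi) Real.pi) :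
    ContinuousOn (fun b => f (a, b)) (Icc (-Real.pi) Real.pi) :=
  hf.comp (by fun_prop) fun _ hb => ⟨ha, hb⟩

variable [NormedSpace ℝ E]

lemma setIntegral_cell {f : ℝ × ℝ → E} (hf : ContinuousOn f cell) :
    ∫ x in cell, f x =
      ∫ a in Icc (-Real.pi) Real.pi, ∫ b in Icc (-Real.pi) Real.pi, f (a, b) :=
  setIntegral_prod f (integrableOn_cell hf)

lemma setIntegral_cell_swap {f : ℝ × ℝ → E} (hf : ContinuousOn f cell) :
    ∫ x in cell, f x =
      ∫ b in Icc (-Real.pi) Real.pi, ∫ a in Icc (-Real.pi) Real.pi, f (a, b) := by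
  rw [setIntegral_cell hf, integral_integral_swap]
  have h := integrableOn_cell hf
  rw [IntegrableOn, Measure.volume_eq_prod, cell, ← Measure.prod_restrict] at h
  exact h

lemma setIntegral_Icc_deriv [CompleteSpace E] {f f' : ℝ → E} {a b : ℝ} (hab : a ≤ b)
    (hf : ∀ x ∈ Icc a b, HasDerivWithinAt f (f' x) (Icc a b) x) (hf' : ContinuousOn f' (Icc a b)) :
    ∫ x in Icc a b, f' x = f b - f a := by
  rw [integral_Icc_eq_integral_Ioc, ← intervalIntegral.integral_of_le hab]
  refine intervalIntegral.integral_eq_sub_of_hasDerivAt_of_le hab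
    (fun x hx => (hf x hx).continuousWithinAt) (fun x hx => ?_)
    (hf'.intervalIntegrable_of_Icc hab)
  exact (hf x (Ioo_subset_Icc_self hx)).hasDerivAt (Icc_mem_nhds hx.1 hx.2)

/-- The integral of an `x₁`-derivative over the cell vanishes when the boundary values on the two
vertical sides agree. -/
lemma setIntegral_cell_deriv_fst [CompleteSpace E] {f f' : ℝ × ℝ → E} (hf' : ContinuousOn f' cell)
    (hf : ∀ x ∈ cell, HasDerivWithinAt (fun a => f (a, x.2)) (f' x) (Icc (-Real.pi) Real.pi) x.1)
    (hper : ∀ b ∈ Icc (-Real.pi) Real.pi, f (Real.pi, b) = f (-Real.pi, b)) :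
    ∫ x in cell, f' x = 0 := by
  rw [setIntegral_cell_swap hf']
  refine (setIntegral_congr_fun measurableSet_Icc (g := fun _ => 0) fun b hb => ?_).trans (by simp)
  have := setIntegral_Icc_deriv (f := fun a => f (a, b)) neg_pi_lt_pi.le
    (fun a ha => hf (a, b) ⟨ha, hb⟩) (continuousOn_slice_fst hf' hb)
  simp [this, hper b hb]

/-- The integral of an `x₂`-derivative over the cell vanishes when the boundary values on the two
horizontal sides agree. -/
lemma setIntegral_cell_deriv_snd [CompleteSpace E] {f f' : ℝ × ℝ → E} (hf' : ContinuousOn f' cell)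
    (hf : ∀ x ∈ cell, HasDerivWithinAt (fun b => f (x.1, b)) (f' x) (Icc (-Real.pi) Real.pi) x.2)
    (hbdy : ∀ a ∈ Icc (-Real.pi) Real.pi, f (a, Real.pi) = f (a, -Real.pi)) :
    ∫ x in cell, f' x = 0 := by
  rw [setIntegral_cell hf']
  refine (setIntegral_congr_fun measurableSet_Icc (g := fun _ => 0) fun a ha => ?_).trans (by simp)
  have := setIntegral_Icc_deriv (f := fun b => f (a, b)) neg_pi_lt_pi.le
    (fun b hb => hf (a, b) ⟨ha, hb⟩) (continuousOn_slice_snd hf' ha)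
  simp [this, hbdy a ha]

end Integration

lemma PeriodicFst.boundary {F : Type*} {f : ℝ × ℝ → F} (hf : PeriodicFst f) {b : ℝ}
    (hb : b ∈ Icc (-Real.pi) Real.pi) : f (Real.pi, b) = f (-Real.pi, b) := by
  have := hf (-Real.pi, b) (mk_mem_strip hb)
  simp only at this
  rw [← this]
  congr 2
  ring

lemma PeriodicFst.periodic {F : Type*} {f : ℝ × ℝ → F} (hf : PeriodicFst f) {b : ℝ}
    (hb : b ∈ Icc (-Real.pi) Real.pi) : Function.Periodic (fun a => f (a, b)) (2 * Real.pi) :=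
  fun a => hf (a, b) (mk_mem_strip hb)

/-- Every value on a horizontal line is attained in the fundamental cell. -/
lemma PeriodicFst.exists_mem_Icc {F : Type*} {f : ℝ × ℝ → F} (hf : PeriodicFst f) (a : ℝ) {b : ℝ}
    (hb : b ∈ Icc (-Real.pi) Real.pi) : ∃ a' ∈ Icc (-Real.pi) Real.pi, f (a, b) = f (a', b) := by
  obtain ⟨y, hy, h⟩ := (hf.periodic hb).exists_mem_Ico (by positivity) a (-Real.pi)
  exact ⟨y, ⟨hy.1, by linarith [hy.2]⟩, h⟩

lemma hasDerivAt_posPart_sq (M r : ℝ) :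
    HasDerivAt (fun r => (max (r - M) 0) ^ 2) (2 * max (r - M) 0) r := by
  rcases lt_trichotomy r M with h | h | h
  · rw [max_eq_right (by linarith)]
    refine (hasDerivAt_const r (0 : ℝ)).congr_deriv (by simp) |>.congr_of_eventuallyEq ?_
    filter_upwards [Iio_mem_nhds h] with y hy
    rw [max_eq_right (by linarith [mem_Iio.1 hy])]; simp
  · subst h
    simp only [sub_self, max_self, mul_zero]
    rw [hasDerivAt_iff_isLittleO]
    simp only [sub_self, max_self, smul_zero, sub_zero]
    have h1 : (fun x' : ℝ => (max (x' - r) 0) ^ 2) =O[nhds r] fun x' => (x' - r) ^ 2 := by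
      refine Asymptotics.IsBigO.of_bound 1 (Eventually.of_forall fun y => ?_)
      rw [one_mul, norm_pow, norm_pow, Real.norm_of_nonneg (le_max_right (y - r) 0)]
      exact pow_le_pow_left₀ (le_max_right _ _) (max_le (le_abs_self _) (abs_nonneg _)) 2
    have h2 : (fun x' : ℝ => (x' - r) ^ 2) =o[nhds r] fun x' => x' - r := by
      have : Tendsto (fun x' : ℝ => x' - r) (nhds r) (nhds 0) := by
        have : Continuous fun x' : ℝ => x' - r := by fun_prop
        simpa using this.tendsto r
      exact (Asymptotics.isLittleO_pow_id one_lt_two).comp_tendsto this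
    simpa using h1.trans_isLittleO h2
  · rw [max_eq_left (by linarith)]
    have : HasDerivAt (fun r => (r - M) ^ 2) (2 * (r - M)) r := by
      simpa using ((hasDerivAt_id r).sub_const M).fun_pow 2
    refine this.congr_of_eventuallyEq ?_
    filter_upwards [Ioi_mem_nhds h] with y hy
    rw [max_eq_left (by linarith [mem_Ioi.1 hy])]

/-- Cauchy--Schwarz on an interval of length `2π`. -/
lemma sq_setIntegral_le {k : ℝ → ℝ} (hk : ContinuousOn k (Icc (-Real.pi) Real.pi)) :
    (∫ x in Icc (-Real.pi) Real.pi, k x) ^ 2 ≤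
      2 * Real.pi * ∫ x in Icc (-Real.pi) Real.pi, k x ^ 2 := by
  set J := ∫ x in Icc (-Real.pi) Real.pi, k x with hJ
  have hi : IntegrableOn k (Icc (-Real.pi) Real.pi) := hk.integrableOn_compact isCompact_Icc
  have hi2 : IntegrableOn (fun x => k x ^ 2) (Icc (-Real.pi) Real.pi) :=
    (hk.pow 2).integrableOn_compact isCompact_Icc
  -- expand `∫ (k - mean)² ≥ 0`
  have h0 : 0 ≤ ∫ x in Icc (-Real.pi) Real.pi, (2 * Real.pi * k x - J) ^ 2 :=
    integral_nonneg fun x => sq_nonneg _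
  have h1 : ∫ x in Icc (-Real.pi) Real.pi, (2 * Real.pi * k x - J) ^ 2
      = (2 * Real.pi) ^ 2 * (∫ x in Icc (-Real.pi) Real.pi, k x ^ 2)
        - 2 * (2 * Real.pi) * J * J + 2 * Real.pi * J ^ 2 := by
    have : ∀ x, (2 * Real.pi * k x - J) ^ 2
        = (2 * Real.pi) ^ 2 * k x ^ 2 - 2 * (2 * Real.pi) * J * k x + J ^ 2 := fun x => by ring
    simp_rw [this]
    have hc : IntegrableOn (fun _ : ℝ => J ^ 2) (Icc (-Real.pi) Real.pi) := by simp
    have ha := hi2.const_mul ((2 * Real.pi) ^ 2)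
    have hb := hi.const_mul (2 * (2 * Real.pi) * J)
    have hab : IntegrableOn (fun x => (2 * Real.pi) ^ 2 * k x ^ 2 - 2 * (2 * Real.pi) * J * k x)
        (Icc (-Real.pi) Real.pi) := ha.sub hb
    rw [integral_add hab hc, integral_sub ha hb, integral_const_mul, integral_const_mul,
      ← hJ, setIntegral_const, Real.volume_real_Icc_of_le neg_pi_lt_pi.le, smul_eq_mul]
    ring
  rw [h1] at h0
  have hp := Real.pi_pos
  have : 0 ≤ 2 * Real.pi * (2 * Real.pi * (∫ x in Icc (-Real.pi) Real.pi, k x ^ 2) - J ^ 2) := by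
    linarith
  have := nonneg_of_mul_nonneg_right this (by positivity)
  linarith

/-! ### Fourier series on the strip -/

lemma memLp_two_of_continuousOn {f : ℝ → ℂ} {K : Set ℝ} (hK : IsCompact K) (hf : ContinuousOn f K) :
    MemLp f 2 (volume.restrict K) := by
  have : IsFiniteMeasure (volume.restrict K) := isFiniteMeasure_restrict.2 hK.measure_lt_top.ne
  obtain ⟨C, hC⟩ := hK.exists_bound_of_continuousOn hf
  exact MemLp.of_bound (hf.aestronglyMeasurable hK.measurableSet) C
    (ae_restrict_of_forall_mem hK.measurableSet hC)

/-- Parseval's identity on an interval, in unnormalised form. -/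
lemma tsum_sq_exp_integral {a b : ℝ} (hab : a < b) {f : ℝ → ℂ}
    (hf : MemLp f 2 (volume.restrict (Ioc a b))) :
    ∑' n : ℤ, ENNReal.ofReal
        (‖∫ x in a..b, Complex.exp (2 * Real.pi * Complex.I * (-n : ℤ) * x / (b - a : ℝ)) * f x‖ ^ 2)
      = ENNReal.ofReal ((b - a) * ∫ x in a..b, ‖f x‖ ^ 2) := by
  have hb : 0 < b - a := sub_pos.2 hab
  have h := (hasSum_sq_fourierCoeffOn hab hf).mul_left ((b - a) ^ 2)
  have hn : ∀ n : ℤ, (b - a) ^ 2 * ‖fourierCoeffOn hab f n‖ ^ 2 =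
      ‖∫ x in a..b,
        Complex.exp (2 * Real.pi * Complex.I * (-n : ℤ) * x / (b - a : ℝ)) * f x‖ ^ 2 := by
    intro n
    rw [fourierCoeffOn_eq_integral, norm_smul, mul_pow, ← mul_assoc, ← mul_pow]
    simp only [fourier_coe_apply, smul_eq_mul]
    rw [Real.norm_of_nonneg (by positivity), mul_one_div_cancel hb.ne', one_pow, one_mul]
  simp only [hn] at h
  rw [← ENNReal.ofReal_tsum_of_nonneg (fun n => sq_nonneg _) h.summable, h.tsum_eq]
  congr 1
  rw [smul_eq_mul]
  field_simp

lemma ofReal_setIntegral_sq {f : ℝ → ℂ} {a b : ℝ} (hf : ContinuousOn f (Icc a b)) :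
    ENNReal.ofReal (∫ x in Icc a b, ‖f x‖ ^ 2) = ∫⁻ x in Icc a b, ENNReal.ofReal (‖f x‖ ^ 2) :=
  ofReal_integral_eq_lintegral_ofReal ((hf.norm.pow 2).integrableOn_compact isCompact_Icc)
    (Eventually.of_forall fun _ => sq_nonneg _)

/-- Parseval's identity for `e^{ipx}` on `[-π, π]`. -/
lemma tsum_sq_integral_exp {f : ℝ → ℂ} (hf : ContinuousOn f (Icc (-Real.pi) Real.pi)) :
    ∑' p : ℤ, ENNReal.ofReal
        (‖∫ a in Icc (-Real.pi) Real.pi, f a * Complex.exp (-(p * a * Complex.I))‖ ^ 2)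
      = ENNReal.ofReal (2 * Real.pi) *
        ∫⁻ a in Icc (-Real.pi) Real.pi, ENNReal.ofReal (‖f a‖ ^ 2) := by
  have hf2 : MemLp f 2 (volume.restrict (Ioc (-Real.pi) Real.pi)) := by
    rw [← Measure.restrict_congr_set Ioc_ae_eq_Icc.symm]
    exact memLp_two_of_continuousOn isCompact_Icc hf
  have h := tsum_sq_exp_integral neg_pi_lt_pi hf2
  rw [show Real.pi - -Real.pi = 2 * Real.pi by ring, ENNReal.ofReal_mul (by positivity),
    intervalIntegral.integral_of_le neg_pi_lt_pi.le, ← integral_Icc_eq_integral_Ioc,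
    ofReal_setIntegral_sq hf] at h
  rw [← h]
  congr 1
  ext p
  rw [intervalIntegral.integral_of_le neg_pi_lt_pi.le, ← integral_Icc_eq_integral_Ioc]
  congr 4
  ext a
  rw [mul_comm]
  congr 2
  have : (Real.pi : ℂ) ≠ 0 := by exact_mod_cast Real.pi_ne_zero
  push_cast
  field_simp

/-- The kernel that integration against `e^{-inz/2}` over `[-2π, 2π]` acquires on functions with
`G(-z) = τ G(z)`: up to a constant a cosine for `τ = 1` and a sine for `τ = -1`. -/
def reflKernel (τ : ℂ) (n : ℤ) (z : ℝ) : ℂ :=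
  Complex.exp (-(n * z / 2 * Complex.I)) + τ * Complex.exp (n * z / 2 * Complex.I)

lemma tsum_sq_integral_reflKernel {h : ℝ → ℂ} (hh : ContinuousOn h (Icc 0 (2 * Real.pi))) {τ : ℂ}
    (hτ : ‖τ‖ = 1) :
    ∑' n : ℤ, ENNReal.ofReal (‖∫ z in 0..(2 * Real.pi), h z * reflKernel τ n z‖ ^ 2)
      = ENNReal.ofReal (8 * Real.pi * ∫ z in 0..(2 * Real.pi), ‖h z‖ ^ 2) := by
  have hpi := Real.pi_pos
  -- the extension of `h` to `[-2π, 2π]` of parity `τ`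
  set G : ℝ → ℂ := (Ioi 0).piecewise h (fun z => τ * h (-z)) with hG
  have hh' : ContinuousOn (fun z => τ * h (-z)) (Icc (-(2 * Real.pi)) 0) :=
    continuousOn_const.mul (hh.comp (by fun_prop) fun z hz => ⟨by linarith [hz.2], by linarith [hz.1]⟩)
  have hGmem : MemLp G 2 (volume.restrict (Ioc (-(2 * Real.pi)) (2 * Real.pi))) := by
    refine MemLp.piecewise measurableSet_Ioi ?_ ?_
    · refine (memLp_two_of_continuousOn isCompact_Icc hh).mono_measure ?_
      rw [Measure.restrict_restrict measurableSet_Ioi]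
      refine Measure.restrict_mono ?_ le_rfl
      exact fun z hz => ⟨(mem_Ioi.1 hz.1).le, hz.2.2⟩
    · refine (memLp_two_of_continuousOn isCompact_Icc hh').mono_measure ?_
      rw [Measure.restrict_restrict measurableSet_Ioi.compl]
      refine Measure.restrict_mono ?_ le_rfl
      exact fun z hz => ⟨hz.2.1.le, by simpa using hz.1⟩
  have hlt : -(2 * Real.pi) < 2 * Real.pi := by linarith
  -- integrals over `[-2π, 2π]` fold onto `[0, 2π]`
  have fold : ∀ {E : Type} [NormedAddCommGroup E] [NormedSpace ℝ E] (F F₁ F₂ : ℝ → E),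
      (∀ z ∈ Ioi (0 : ℝ), F z = F₁ z) → (∀ z ∈ Iic (0 : ℝ), F z = F₂ (-z)) →
      ContinuousOn F₁ (Icc 0 (2 * Real.pi)) → ContinuousOn F₂ (Icc 0 (2 * Real.pi)) →
      ∫ z in (-(2 * Real.pi))..(2 * Real.pi), F z = ∫ z in 0..(2 * Real.pi), (F₁ z + F₂ z) := by
    intro E _ _ F F₁ F₂ h1 h2 c1 c2
    have i1 : IntervalIntegrable F₁ volume 0 (2 * Real.pi) :=
      c1.intervalIntegrable_of_Icc (by positivity)
    have i2 : IntervalIntegrable F₂ volume 0 (2 * Real.pi) :=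
      c2.intervalIntegrable_of_Icc (by positivity)
    have i1' : IntervalIntegrable F volume 0 (2 * Real.pi) := by
      refine i1.congr fun z hz => ?_
      rw [uIoc_of_le (by positivity)] at hz
      exact (h1 z hz.1).symm
    have e2 : EqOn (fun z => F₂ (-z)) F (uIoc (-(2 * Real.pi)) 0) := by
      intro z hz
      rw [uIoc_of_le (by linarith)] at hz
      exact (h2 z hz.2).symm
    have i2' : IntervalIntegrable F volume (-(2 * Real.pi)) 0 := by
      refine IntervalIntegrable.congr e2 ?_
      have := ((IntervalIntegrable.iff_comp_neg (f := F₂) (a := 0) (b := 2 * Real.pi)).1 i2).symm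
      simpa using this
    rw [← intervalIntegral.integral_add_adjacent_intervals i2' i1',
      intervalIntegral.integral_add i1 i2, add_comm]
    congr 1
    · refine intervalIntegral.integral_congr_uIoo ?_
      intro z hz
      rw [uIoo_of_le (by positivity)] at hz
      exact h1 z hz.1
    · rw [← intervalIntegral.integral_congr_uIoo (f := fun z => F₂ (-z))]
      · simp [intervalIntegral.integral_comp_neg]
      · intro z hz
        rw [uIoo_of_le (by linarith)] at hz
        exact (h2 z hz.2.le).symm
  have key := tsum_sq_exp_integral hlt hGmem
  have hGp : ∀ z ∈ Ioi (0 : ℝ), G z = h z := fun z hz => by simp [hG, mem_Ioi.1 hz]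
  have hGn : ∀ z ∈ Iic (0 : ℝ), G z = τ * h (-z) := fun z hz => by
    simp [hG, not_lt.2 (mem_Iic.1 hz)]
  rw [fold (fun z => ‖G z‖ ^ 2) (fun z => ‖h z‖ ^ 2) (fun z => ‖h z‖ ^ 2)
    (fun z hz => by simp only [hGp z hz]) (fun z hz => by simp only [hGn z hz, norm_mul, hτ, one_mul])
    (hh.norm.pow 2) (hh.norm.pow 2)] at key
  have hint : (2 * Real.pi - -(2 * Real.pi)) * ∫ z in 0..(2 * Real.pi), (‖h z‖ ^ 2 + ‖h z‖ ^ 2)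
      = 8 * Real.pi * ∫ z in 0..(2 * Real.pi), ‖h z‖ ^ 2 := by
    have : ∀ z, ‖h z‖ ^ 2 + ‖h z‖ ^ 2 = 2 * ‖h z‖ ^ 2 := fun z => by ring
    simp_rw [this]
    rw [intervalIntegral.integral_const_mul]
    ring
  rw [hint] at key
  rw [← key]
  congr 1
  ext n
  have hpi0 : (Real.pi : ℂ) ≠ 0 := by exact_mod_cast Real.pi_ne_zero
  rw [fold _ (fun z => Complex.exp (-(n * z / 2 * Complex.I)) * h z)
    (fun z => Complex.exp (n * z / 2 * Complex.I) * (τ * h z))]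
  · congr 4
    ext z
    rw [reflKernel]
    ring
  · intro z hz
    simp only [hGp z hz]
    congr 2
    push_cast
    field_simp
    ring
  · intro z hz
    simp only [hGn z hz]
    congr 2
    push_cast
    field_simp
    ring
  · exact (Continuous.continuousOn (by fun_prop)).mul hh
  · exact (Continuous.continuousOn (by fun_prop)).mul (continuousOn_const.mul hh)

/-- The normalised derivative of `eigenfactor`: `eigenfactor q` has derivative
`q / 2 * coeigenfactor q`. -/
def coeigenfactor (q : ℕ) (y : ℝ) : ℝ :=
  if Odd q then -Real.sin (q * y / 2) else Real.cos (q * y / 2)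

lemma continuous_eigenfactor (q : ℕ) : Continuous (eigenfactor q) := by
  unfold eigenfactor; split_ifs <;> fun_prop

lemma continuous_coeigenfactor (q : ℕ) : Continuous (coeigenfactor q) := by
  unfold coeigenfactor; split_ifs <;> fun_prop

lemma hasDerivAt_eigenfactor (q : ℕ) (y : ℝ) :
    HasDerivAt (eigenfactor q) (q / 2 * coeigenfactor q y) y := by
  have h : HasDerivAt (fun y : ℝ => q * y / 2) (q / 2 : ℝ) y := by
    simpa using ((hasDerivAt_id y).const_mul (q : ℝ)).div_const 2
  unfold eigenfactor coeigenfactor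
  split_ifs with hq
  · exact h.cos.congr_deriv (by ring)
  · exact h.sin.congr_deriv (by ring)

lemma hasDerivAt_coeigenfactor (q : ℕ) (y : ℝ) :
    HasDerivAt (coeigenfactor q) (-(q / 2 * eigenfactor q y)) y := by
  have h : HasDerivAt (fun y : ℝ => q * y / 2) (q / 2 : ℝ) y := by
    simpa using ((hasDerivAt_id y).const_mul (q : ℝ)).div_const 2
  unfold eigenfactor coeigenfactor
  split_ifs with hq
  · exact h.sin.neg.congr_deriv (by ring)
  · exact h.cos.congr_deriv (by ring)

lemma eigenfactor_pi (q : ℕ) : eigenfactor q Real.pi = 0 := by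
  unfold eigenfactor
  split_ifs with hq
  · obtain ⟨k, rfl⟩ := hq
    rw [Real.cos_eq_zero_iff]
    exact ⟨k, by push_cast; ring⟩
  · obtain ⟨k, rfl⟩ := Nat.not_odd_iff_even.1 hq
    rw [Real.sin_eq_zero_iff]
    exact ⟨k, by push_cast; ring⟩

lemma eigenfactor_neg_pi (q : ℕ) : eigenfactor q (-Real.pi) = 0 := by
  have h := eigenfactor_pi q
  unfold eigenfactor at *
  split_ifs at * with hq <;> simpa [neg_div] using h

/-- Up to sign, `eigenfactor q` is the sine of the distance to the bottom of the strip, and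
`coeigenfactor q` the cosine. -/
lemma exists_sign_eigenfactor (q : ℕ) : ∃ σ : ℝ, |σ| = 1 ∧ ∀ y,
    Real.sin (q * (y + Real.pi) / 2) = σ * eigenfactor q y ∧
    Real.cos (q * (y + Real.pi) / 2) = σ * coeigenfactor q y := by
  unfold eigenfactor coeigenfactor
  by_cases hq : Odd q
  · obtain ⟨k, rfl⟩ := id hq
    refine ⟨(-1) ^ k, by simp [abs_pow], fun y => ?_⟩
    simp only [hq, if_true]
    have : ((2 * k + 1 : ℕ) : ℝ) * (y + Real.pi) / 2
        = ((2 * k + 1 : ℕ) : ℝ) * y / 2 + Real.pi / 2 + k * Real.pi := by push_cast; ring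
    rw [this, Real.sin_add_nat_mul_pi, Real.cos_add_nat_mul_pi, Real.sin_add_pi_div_two,
      Real.cos_add_pi_div_two]
    simp
  · obtain ⟨k, rfl⟩ := Nat.not_odd_iff_even.1 hq
    refine ⟨(-1) ^ k, by simp [abs_pow], fun y => ?_⟩
    simp only [hq, if_false]
    have : ((k + k : ℕ) : ℝ) * (y + Real.pi) / 2
        = ((k + k : ℕ) : ℝ) * y / 2 + k * Real.pi := by push_cast; ring
    rw [this, Real.sin_add_nat_mul_pi, Real.cos_add_nat_mul_pi]
    simp

/-- The half-line sum of the reflected coefficients, with the zero mode counted separately. -/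
lemma tsum_sq_reflKernel_nat {g : ℝ → ℂ} (hg : ContinuousOn g (Icc (-Real.pi) Real.pi)) {τ : ℂ}
    (hτ : τ ^ 2 = 1) (c : ℝ) (B : ℕ → ℝ → ℝ)
    (hB : ∀ n : ℕ, ∃ w : ℂ, ‖w‖ = 2 ∧
      ∀ y, reflKernel τ (n + 1 : ℕ) (y + Real.pi) = w * B (n + 1) y)
    (hc : c = ‖∫ z in 0..(2 * Real.pi), g (z - Real.pi) * reflKernel τ 0 z‖ ^ 2) :
    ENNReal.ofReal c + 8 * ∑' n : ℕ, ENNReal.ofReal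
        (‖∫ y in Icc (-Real.pi) Real.pi, g y * B (n + 1) y‖ ^ 2)
      = 8 * (ENNReal.ofReal Real.pi *
        ∫⁻ y in Icc (-Real.pi) Real.pi, ENNReal.ofReal (‖g y‖ ^ 2)) := by
  have hpi := Real.pi_pos
  have hτ1 : ‖τ‖ = 1 := by
    have : ‖τ‖ ^ 2 = 1 := by rw [← norm_pow, hτ, norm_one]
    exact (pow_eq_one_iff_of_nonneg (norm_nonneg τ) two_ne_zero).1 this
  have hh : ContinuousOn (fun z => g (z - Real.pi)) (Icc 0 (2 * Real.pi)) :=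
    hg.comp (by fun_prop) fun z hz => ⟨by linarith [hz.1], by linarith [hz.2]⟩
  have key := tsum_sq_integral_reflKernel hh hτ1
  have shift : ∀ {E : Type} [NormedAddCommGroup E] [NormedSpace ℝ E] (F : ℝ → E),
      ∫ z in 0..(2 * Real.pi), F (z - Real.pi) = ∫ y in Icc (-Real.pi) Real.pi, F y := by
    intro E _ _ F
    rw [intervalIntegral.integral_comp_sub_right, integral_Icc_eq_integral_Ioc,
      ← intervalIntegral.integral_of_le neg_pi_lt_pi.le]
    congr 1 <;> ring
  have coef : ∀ n : ℕ, ENNReal.ofReal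
      (‖∫ z in 0..(2 * Real.pi), g (z - Real.pi) * reflKernel τ (n + 1 : ℕ) z‖ ^ 2)
      = 4 * ENNReal.ofReal (‖∫ y in Icc (-Real.pi) Real.pi, g y * B (n + 1) y‖ ^ 2) := by
    intro n
    obtain ⟨w, hw, hy⟩ := hB n
    have := shift fun y => g y * reflKernel τ (n + 1 : ℕ) (y + Real.pi)
    simp only [sub_add_cancel] at this
    rw [this]
    have e : ∀ y, g y * reflKernel τ (n + 1 : ℕ) (y + Real.pi) = w * (g y * B (n + 1) y) := by
      intro y; rw [hy]; ring
    simp_rw [e]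
    rw [integral_const_mul, norm_mul, hw, mul_pow, ENNReal.ofReal_mul (by norm_num)]
    norm_num
  have neg : ∀ m : ℤ, ‖∫ z in 0..(2 * Real.pi), g (z - Real.pi) * reflKernel τ (-m) z‖
      = ‖∫ z in 0..(2 * Real.pi), g (z - Real.pi) * reflKernel τ m z‖ := by
    intro m
    have e : ∀ z, g (z - Real.pi) * reflKernel τ (-m) z
        = τ * (g (z - Real.pi) * reflKernel τ m z) := by
      intro z
      simp only [reflKernel]
      push_cast
      have e1 : -(-(m : ℂ) * z / 2 * Complex.I) = m * z / 2 * Complex.I := by ring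
      have e2 : (-(m : ℂ) * z / 2 * Complex.I) = -(m * z / 2 * Complex.I) := by ring
      rw [e1, e2]
      linear_combination
        -(g (z - Real.pi) * Complex.exp (m * z / 2 * Complex.I)) * hτ
    simp_rw [e]
    rw [intervalIntegral.integral_const_mul, norm_mul, hτ1, one_mul]
  rw [tsum_of_add_one_of_neg_add_one ENNReal.summable ENNReal.summable] at key
  simp only [neg] at key
  have coef' : ∀ n : ℕ, ENNReal.ofReal
      (‖∫ z in 0..(2 * Real.pi), g (z - Real.pi) * reflKernel τ ((n : ℤ) + 1) z‖ ^ 2)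
      = 4 * ENNReal.ofReal (‖∫ y in Icc (-Real.pi) Real.pi, g y * B (n + 1) y‖ ^ 2) := fun n => by
    rw [← coef n]; push_cast; rfl
  simp only [coef'] at key
  rw [shift (fun y => ‖g y‖ ^ 2), ENNReal.tsum_mul_left, ← hc, ENNReal.ofReal_mul (by positivity),
    ENNReal.ofReal_mul (by norm_num), ofReal_setIntegral_sq hg] at key
  rw [show ENNReal.ofReal 8 = 8 by norm_num, mul_assoc] at key
  rw [← key]
  ring

lemma reflKernel_neg_one (n : ℕ) (z : ℝ) :
    reflKernel (-1) n z = -(2 * Complex.I) * (Real.sin (n * z / 2) : ℝ) := by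
  rw [reflKernel, Complex.ofReal_sin, Complex.sin]
  push_cast
  rw [neg_mul_eq_neg_mul]
  linear_combination (Complex.exp (-(n * z / 2) * Complex.I) - Complex.exp (n * z / 2 * Complex.I))
    * Complex.I_sq

lemma reflKernel_one (n : ℕ) (z : ℝ) :
    reflKernel 1 n z = 2 * (Real.cos (n * z / 2) : ℝ) := by
  rw [reflKernel, Complex.ofReal_cos, Complex.cos]
  push_cast
  rw [neg_mul_eq_neg_mul]
  ring

/-- Parseval's identity for the Dirichlet factors on `[-π, π]`. -/
lemma tsum_sq_integral_eigenfactor {g : ℝ → ℂ} (hg : ContinuousOn g (Icc (-Real.pi) Real.pi)) :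
    ∑' n : ℕ, ENNReal.ofReal
        (‖∫ y in Icc (-Real.pi) Real.pi, g y * eigenfactor (n + 1) y‖ ^ 2)
      = ENNReal.ofReal Real.pi *
        ∫⁻ y in Icc (-Real.pi) Real.pi, ENNReal.ofReal (‖g y‖ ^ 2) := by
  have h := tsum_sq_reflKernel_nat hg (τ := -1) (by norm_num) 0 eigenfactor (fun n => by
    obtain ⟨σ, hσ, hy⟩ := exists_sign_eigenfactor (n + 1)
    refine ⟨-(2 * Complex.I) * σ, by simp [hσ], fun y => ?_⟩
    rw [reflKernel_neg_one, (hy y).1]; push_cast; ring) (by simp [reflKernel])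
  rw [ENNReal.ofReal_zero, zero_add] at h
  exact (ENNReal.mul_right_inj (by norm_num) (by norm_num)).1 h

/-- Bessel's inequality for the Neumann factors on `[-π, π]`. -/
lemma tsum_sq_integral_coeigenfactor_le {g : ℝ → ℂ}
    (hg : ContinuousOn g (Icc (-Real.pi) Real.pi)) :
    ∑' n : ℕ, ENNReal.ofReal
        (‖∫ y in Icc (-Real.pi) Real.pi, g y * coeigenfactor (n + 1) y‖ ^ 2)
      ≤ ENNReal.ofReal Real.pi *
        ∫⁻ y in Icc (-Real.pi) Real.pi, ENNReal.ofReal (‖g y‖ ^ 2) := by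
  have h := tsum_sq_reflKernel_nat hg (τ := 1) (by norm_num) _ coeigenfactor (fun n => by
    obtain ⟨σ, hσ, hy⟩ := exists_sign_eigenfactor (n + 1)
    refine ⟨2 * σ, by simp [hσ], fun y => ?_⟩
    rw [reflKernel_one, (hy y).2]; push_cast; ring) rfl
  exact (ENNReal.mul_le_mul_iff_right (by norm_num) (by norm_num)).1 (le_add_self.trans_eq h)

/-- The `p`-th Fourier coefficient in `x₁`, as a function of `x₂`. -/
def fibre (f : ℝ × ℝ → ℂ) (p : ℤ) (y : ℝ) : ℂ :=
  ∫ a in Icc (-Real.pi) Real.pi, f (a, y) * Complex.exp (-(p * a * Complex.I))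

lemma continuousOn_fibre {f : ℝ × ℝ → ℂ} (hf : ContinuousOn f cell) (p : ℤ) :
    ContinuousOn (fibre f p) (Icc (-Real.pi) Real.pi) := by
  obtain ⟨C, hC⟩ := isCompact_cell.exists_bound_of_continuousOn hf
  refine continuousOn_of_dominated (bound := fun _ => C) (fun y hy => ?_) (fun y hy => ?_)
    (by simp) ?_
  · exact ((continuousOn_slice_fst hf hy).mul (Continuous.continuousOn (by fun_prop))
      ).aestronglyMeasurable measurableSet_Icc
  · refine ae_restrict_of_forall_mem measurableSet_Icc fun a ha => ?_
    have : -(p * a * Complex.I) = ((-(p * a) : ℝ) : ℂ) * Complex.I := by push_cast; ring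
    rw [norm_mul, this, Complex.norm_exp_ofReal_mul_I, mul_one]
    exact hC _ ⟨ha, hy⟩
  · exact ae_restrict_of_forall_mem measurableSet_Icc fun a ha =>
      (continuousOn_slice_snd hf ha).mul continuousOn_const

lemma setIntegral_cell_mul_exp_mul {f : ℝ × ℝ → ℂ} (hf : ContinuousOn f cell) (p : ℤ)
    {B : ℝ → ℝ} (hB : Continuous B) :
    ∫ x in cell, f x * (Complex.exp (-(p * x.1 * Complex.I)) * B x.2)
      = ∫ y in Icc (-Real.pi) Real.pi, fibre f p y * B y := by
  have hcont : ContinuousOn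
      (fun x : ℝ × ℝ => f x * (Complex.exp (-(p * x.1 * Complex.I)) * B x.2)) cell :=
    hf.mul (Continuous.continuousOn (by fun_prop))
  rw [setIntegral_cell_swap hcont]
  refine setIntegral_congr_fun measurableSet_Icc fun y _ => ?_
  simp only [fibre, ← integral_mul_const, mul_assoc]

lemma tsum_lintegral_fibre {f : ℝ × ℝ → ℂ} (hf : ContinuousOn f cell) :
    ∑' p : ℤ, ∫⁻ y in Icc (-Real.pi) Real.pi, ENNReal.ofReal (‖fibre f p y‖ ^ 2)
      = ENNReal.ofReal (2 * Real.pi * ∫ x in cell, ‖f x‖ ^ 2) := by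
  have hn : ContinuousOn (fun x => ‖f x‖ ^ 2) cell := hf.norm.pow 2
  have hm : ∀ p, AEMeasurable (fun y => ENNReal.ofReal (‖fibre f p y‖ ^ 2))
      (volume.restrict (Icc (-Real.pi) Real.pi)) := fun p =>
    (((continuousOn_fibre hf p).norm.pow 2).aemeasurable measurableSet_Icc).ennreal_ofReal
  rw [← lintegral_tsum hm, ENNReal.ofReal_mul (by positivity),
    ofReal_integral_eq_lintegral_ofReal (integrableOn_cell hn)
      (Eventually.of_forall fun _ => sq_nonneg _), Measure.volume_eq_prod, cell,
    ← Measure.prod_restrict, lintegral_prod_symm _ (by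
      rw [Measure.prod_restrict]
      exact (hn.aemeasurable measurableSet_cell).ennreal_ofReal),
    ← lintegral_const_mul' _ _ ENNReal.ofReal_ne_top]
  refine setLIntegral_congr_fun measurableSet_Icc fun y hy => ?_
  exact tsum_sq_integral_exp (continuousOn_slice_fst hf hy)

lemma coeff_eq (f : ℝ × ℝ → ℝ) (p : ℤ) (q : ℕ) :
    coeff f p q = ((Real.sqrt 2 * Real.pi : ℝ) : ℂ)⁻¹ *
      ∫ x in cell, (f x : ℂ) * (Complex.exp (-(p * x.1 * Complex.I)) * eigenfactor q x.2) := by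
  rw [coeff, ← integral_const_mul]
  congr 1
  ext x
  rw [eigenfunction, map_div₀, map_mul, Complex.conj_ofReal, Complex.conj_ofReal,
    ← Complex.exp_conj]
  simp only [map_mul, Complex.conj_ofReal, Complex.conj_I, map_intCast]
  rw [mul_neg]
  ring

/-- The coefficients against `e^{ipx₁}` times the Neumann factors, normalised like `coeff`. -/
def cocoeff (f : ℝ × ℝ → ℝ) (p : ℤ) (q : ℕ) : ℂ :=
  ((Real.sqrt 2 * Real.pi : ℝ) : ℂ)⁻¹ *
    ∫ x in cell, (f x : ℂ) * (Complex.exp (-(p * x.1 * Complex.I)) * coeigenfactor q x.2)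

lemma ofReal_norm_normalised_sq (z : ℂ) :
    ENNReal.ofReal (‖((Real.sqrt 2 * Real.pi : ℝ) : ℂ)⁻¹ * z‖ ^ 2)
      = ENNReal.ofReal (2 * Real.pi ^ 2)⁻¹ * ENNReal.ofReal (‖z‖ ^ 2) := by
  rw [norm_mul, norm_inv, Complex.norm_real, Real.norm_of_nonneg (by positivity), mul_pow, inv_pow,
    mul_pow, Real.sq_sqrt (by norm_num), ENNReal.ofReal_mul (by positivity)]

lemma normalisation (X : ℝ) : ENNReal.ofReal (2 * Real.pi ^ 2)⁻¹ *
    (ENNReal.ofReal Real.pi * ENNReal.ofReal (2 * Real.pi * X)) = ENNReal.ofReal X := by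
  have := Real.pi_pos
  rw [← ENNReal.ofReal_mul (by positivity), ← ENNReal.ofReal_mul (by positivity)]
  congr 1
  field_simp

/-- Parseval's identity for the Dirichlet eigenfunctions. -/
theorem tsum_sq_coeff {f : ℝ × ℝ → ℝ} (hf : ContinuousOn f cell) :
    ∑' k : ℤ × ℕ, ENNReal.ofReal (‖coeff f k.1 (k.2 + 1)‖ ^ 2)
      = ENNReal.ofReal (∫ x in cell, f x ^ 2) := by
  have hc : ContinuousOn (fun x => (f x : ℂ)) cell := Complex.continuous_ofReal.comp_continuousOn hf
  simp only [coeff_eq, ofReal_norm_normalised_sq,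
    setIntegral_cell_mul_exp_mul hc _ (continuous_eigenfactor _)]
  rw [ENNReal.tsum_mul_left, ENNReal.tsum_prod (f := fun p n => ENNReal.ofReal
    (‖∫ y in Icc (-Real.pi) Real.pi, fibre (fun x => (f x : ℂ)) p y * eigenfactor (n + 1) y‖ ^ 2))]
  simp only [tsum_sq_integral_eigenfactor (continuousOn_fibre hc _)]
  rw [ENNReal.tsum_mul_left, tsum_lintegral_fibre hc, normalisation]
  simp

/-- Bessel's inequality for `e^{ipx₁}` times the Neumann factors. -/
theorem tsum_sq_cocoeff_le {f : ℝ × ℝ → ℝ} (hf : ContinuousOn f cell) :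
    ∑' k : ℤ × ℕ, ENNReal.ofReal (‖cocoeff f k.1 (k.2 + 1)‖ ^ 2)
      ≤ ENNReal.ofReal (∫ x in cell, f x ^ 2) := by
  have hc : ContinuousOn (fun x => (f x : ℂ)) cell := Complex.continuous_ofReal.comp_continuousOn hf
  simp only [cocoeff, ofReal_norm_normalised_sq,
    setIntegral_cell_mul_exp_mul hc _ (continuous_coeigenfactor _)]
  rw [ENNReal.tsum_mul_left, ENNReal.tsum_prod (f := fun p n => ENNReal.ofReal
    (‖∫ y in Icc (-Real.pi) Real.pi,
      fibre (fun x => (f x : ℂ)) p y * coeigenfactor (n + 1) y‖ ^ 2))]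
  refine (mul_le_mul_right (ENNReal.tsum_le_tsum fun p =>
    tsum_sq_integral_coeigenfactor_le (continuousOn_fibre hc p)) _).trans_eq ?_
  rw [ENNReal.tsum_mul_left, tsum_lintegral_fibre hc, normalisation]
  simp

/-! ### Energy and transport balances -/

lemma uniqueDiffOn_spacetime : UniqueDiffOn ℝ (Ici (0 : ℝ) ×ˢ strip) :=
  (uniqueDiffOn_Ici 0).prod uniqueDiffOn_strip

/-- Parametric integrals over the cell of a jointly continuous function are continuous. -/
lemma continuousOn_setIntegral_cell {K : Set ℝ} (hK : IsCompact K) {k : ℝ → ℝ × ℝ → ℝ}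
    (hk : ContinuousOn (fun z : ℝ × (ℝ × ℝ) => k z.1 z.2) (K ×ˢ cell)) :
    ContinuousOn (fun t => ∫ x in cell, k t x) K := by
  obtain ⟨C, hC⟩ := (hK.prod isCompact_cell).exists_bound_of_continuousOn hk
  refine continuousOn_of_dominated (bound := fun _ => C) (fun t ht => ?_) (fun t ht => ?_) ?_ ?_
  · exact ContinuousOn.aestronglyMeasurable
      (hk.comp (f := fun x => (t, x)) (by fun_prop) fun x hx => ⟨ht, hx⟩) measurableSet_cell
  · exact ae_restrict_of_forall_mem measurableSet_cell fun x hx => hC (t, x) ⟨ht, hx⟩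
  · exact integrableOn_cell continuousOn_const
  · exact ae_restrict_of_forall_mem measurableSet_cell fun x hx =>
      hk.comp (f := fun t => (t, x)) (by fun_prop) fun t ht => ⟨ht, hx⟩

lemma hasDerivAt_exp_neg (k : ℤ) (a : ℝ) :
    HasDerivAt (fun a : ℝ => Complex.exp (-(k * a * Complex.I)))
      (-(k * Complex.I) * Complex.exp (-(k * a * Complex.I))) a := by
  have h1 : HasDerivAt (fun a : ℝ => -((k : ℂ) * a * Complex.I)) (-(k * Complex.I)) a := by
    simpa using ((Complex.ofRealCLM.hasDerivAt (x := a)).const_mul (k : ℂ)).mul_const Complex.I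
      |>.fun_neg
  exact h1.cexp.congr_deriv (by ring)

lemma exp_neg_boundary (k : ℤ) : Complex.exp (-(k * Real.pi * Complex.I))
    = Complex.exp (-(k * (-Real.pi : ℝ) * Complex.I)) := by
  rw [Complex.exp_eq_exp_iff_exists_int]
  exact ⟨-k, by push_cast; ring⟩

namespace IsGlobalSmoothSolution

variable {ρ : ℝ → ℝ × ℝ → ℝ} {u : ℝ → ℝ × ℝ → ℝ × ℝ} {p : ℝ → ℝ × ℝ → ℝ}

lemma contDiffOn_density (h : IsGlobalSmoothSolution ρ u p) {t : ℝ} (ht : 0 ≤ t) :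
    ContDiffOn ℝ ∞ (ρ t) strip :=
  h.smooth_density.comp (f := fun x : ℝ × ℝ => (t, x)) (by fun_prop) fun _ hx => ⟨ht, hx⟩

lemma contDiffOn_velocity (h : IsGlobalSmoothSolution ρ u p) {t : ℝ} (ht : 0 ≤ t) :
    ContDiffOn ℝ ∞ (u t) strip :=
  h.smooth_velocity.comp (f := fun x : ℝ × ℝ => (t, x)) (by fun_prop) fun _ hx => ⟨ht, hx⟩

lemma contDiffOn_velocity_fst (h : IsGlobalSmoothSolution ρ u p) {t : ℝ} (ht : 0 ≤ t) :
    ContDiffOn ℝ ∞ (fun y => (u t y).1) strip := (h.contDiffOn_velocity ht).fst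

lemma contDiffOn_velocity_snd (h : IsGlobalSmoothSolution ρ u p) {t : ℝ} (ht : 0 ≤ t) :
    ContDiffOn ℝ ∞ (fun y => (u t y).2) strip := (h.contDiffOn_velocity ht).snd

lemma smoothOnStrip (h : IsGlobalSmoothSolution ρ u p) {t : ℝ} (ht : 0 ≤ t) :
    SmoothOnStrip (ρ t) := ⟨h.contDiffOn_density ht, h.periodic_density t ht⟩

lemma hasDerivWithinAt_time (h : IsGlobalSmoothSolution ρ u p) {t : ℝ} (ht : 0 ≤ t) {x : ℝ × ℝ}
    (hx : x ∈ strip) :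
    HasDerivWithinAt (fun τ => ρ τ x) (derivWithin (fun τ => ρ τ x) (Ici 0) t) (Ici 0) t := by
  have h1 : ContDiffOn ℝ ∞ (fun τ => ρ τ x) (Ici 0) :=
    h.smooth_density.comp (f := fun τ : ℝ => (τ, x)) (by fun_prop) fun _ hτ => ⟨hτ, hx⟩
  exact (h1.differentiableOn (by simp) t ht).hasDerivWithinAt

lemma continuousOn_time_deriv (h : IsGlobalSmoothSolution ρ u p) :
    ContinuousOn (fun z : ℝ × (ℝ × ℝ) => derivWithin (fun τ => ρ τ z.2) (Ici 0) z.1)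
      (Ici 0 ×ˢ strip) := by
  have hc : ContinuousOn (fun z => fderivWithin ℝ (fun z : ℝ × (ℝ × ℝ) => ρ z.1 z.2)
      (Ici 0 ×ˢ strip) z (1, 0)) (Ici 0 ×ˢ strip) :=
    (h.smooth_density.continuousOn_fderivWithin uniqueDiffOn_spacetime (by simp)).clm_apply
      continuousOn_const
  refine hc.congr fun z hz => ?_
  have h1 := (h.smooth_density.differentiableOn (by simp) z hz).hasFDerivWithinAt
  have h2 : HasDerivWithinAt (fun τ : ℝ => (τ, z.2)) ((1 : ℝ), (0 : ℝ × ℝ)) (Ici 0) z.1 :=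
    (hasDerivWithinAt_id _ _).prodMk (hasDerivWithinAt_const _ _ _)
  have hm : MapsTo (fun τ : ℝ => (τ, z.2)) (Ici 0) (Ici 0 ×ˢ strip) := fun τ hτ => ⟨hτ, hz.2⟩
  exact (h1.comp_hasDerivWithinAt z.1 h2 hm).derivWithin (uniqueDiffOn_Ici 0 _ hz.1)

/-- The weak form of `∂ₜF(ρ) + div (u F(ρ)) = 0` against a weight that depends on `x₂` only. -/
lemma setIntegral_deriv_mul (h : IsGlobalSmoothSolution ρ u p) {F F' W W' : ℝ → ℝ}
    (hF : ∀ r, HasDerivAt F (F' r) r) (hF' : Continuous F')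
    (hW : ∀ y, HasDerivAt W (W' y) y) (hW' : Continuous W') {t : ℝ} (ht : 0 ≤ t) :
    ∫ x in cell, F' (ρ t x) * derivWithin (fun τ => ρ τ x) (Ici 0) t * W x.2
      = ∫ x in cell, F (ρ t x) * (u t x).2 * W' x.2 := by
  have hρ := h.contDiffOn_density ht
  have hu1 := h.contDiffOn_velocity_fst ht
  have hu2 := h.contDiffOn_velocity_snd ht
  have cF : Continuous F := continuous_iff_continuousAt.2 fun r => (hF r).continuousAt
  have cW : Continuous W := continuous_iff_continuousAt.2 fun y => (hW y).continuousAt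
  have sub := cell_subset_strip
  have c0 := hρ.continuousOn.mono sub
  have c1 := hu1.continuousOn.mono sub
  have c2 := hu2.continuousOn.mono sub
  have cd1 := (continuousOn_d1 hρ).mono sub
  have cd2 := (continuousOn_d2 hρ).mono sub
  have ce1 := (continuousOn_d1 hu1).mono sub
  have ce2 := (continuousOn_d2 hu2).mono sub
  have cFρ : ContinuousOn (fun x => F (ρ t x)) cell := cF.comp_continuousOn c0
  have cF'ρ : ContinuousOn (fun x => F' (ρ t x)) cell := hF'.comp_continuousOn c0
  have cWx : ContinuousOn (fun x : ℝ × ℝ => W x.2) cell := (cW.comp continuous_snd).continuousOn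
  have cW'x : ContinuousOn (fun x : ℝ × ℝ => W' x.2) cell := (hW'.comp continuous_snd).continuousOn
  have cg1 : ContinuousOn (fun x => (F' (ρ t x) * d1 (ρ t) x * (u t x).1
      + F (ρ t x) * d1 (fun y => (u t y).1) x) * W x.2) cell := by fun_prop
  have cg2 : ContinuousOn (fun x => (F' (ρ t x) * d2 (ρ t) x * (u t x).2
      + F (ρ t x) * d2 (fun y => (u t y).2) x) * W x.2 + F (ρ t x) * (u t x).2 * W' x.2) cell := by
    fun_prop
  have i1 := setIntegral_cell_deriv_fst (f := fun x => F (ρ t x) * (u t x).1 * W x.2) cg1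
    (fun x hx => ((((hF _).comp_hasDerivWithinAt x.1 (hasDerivAt_d1 hρ (sub hx)).hasDerivWithinAt).mul
      (hasDerivAt_d1 hu1 (sub hx)).hasDerivWithinAt).mul_const (W x.2)))
    (fun b hb => by
      simp only [(h.periodic_density t ht).boundary hb, (h.periodic_velocity t ht).boundary hb])
  have i2 := setIntegral_cell_deriv_snd (f := fun x => F (ρ t x) * (u t x).2 * W x.2) cg2
    (fun x hx => (((hF _).comp_hasDerivWithinAt x.2 (hasDerivWithinAt_d2 hρ (sub hx))).mul
      (hasDerivWithinAt_d2 hu2 (sub hx))).mul (hW x.2).hasDerivWithinAt)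
    (fun a _ => by simp [h.no_flow t ht a])
  have cG : ContinuousOn (fun x => F (ρ t x) * (u t x).2 * W' x.2) cell := by fun_prop
  have hsum := integral_add (integrableOn_cell cg1) (integrableOn_cell cg2)
  rw [i1, i2, add_zero] at hsum
  have e : ∀ x ∈ cell, F' (ρ t x) * derivWithin (fun τ => ρ τ x) (Ici 0) t * W x.2
      = F (ρ t x) * (u t x).2 * W' x.2 - ((F' (ρ t x) * d1 (ρ t) x * (u t x).1
      + F (ρ t x) * d1 (fun y => (u t y).1) x) * W x.2 + ((F' (ρ t x) * d2 (ρ t) x * (u t x).2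
      + F (ρ t x) * d2 (fun y => (u t y).2) x) * W x.2 + F (ρ t x) * (u t x).2 * W' x.2)) := by
    intro x hx
    have t1 := h.transport t ht x (sub hx)
    have t2 := h.incompressible t ht x (sub hx)
    linear_combination (F' (ρ t x) * W x.2) * t1 + (F (ρ t x) * W x.2) * t2
  rw [setIntegral_congr_fun measurableSet_cell e,
    integral_sub (integrableOn_cell cG) (integrableOn_cell (by fun_prop)), hsum, sub_zero]

/-- The balance law for `∫ F(ρ) W(x₂)`. -/
lemma setIntegral_transport_sub (h : IsGlobalSmoothSolution ρ u p) {F F' W W' : ℝ → ℝ}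
    (hF : ∀ r, HasDerivAt F (F' r) r) (hF' : Continuous F')
    (hW : ∀ y, HasDerivAt W (W' y) y) (hW' : Continuous W') {s t : ℝ} (hs : 0 ≤ s) (hst : s ≤ t) :
    (∫ x in cell, F (ρ t x) * W x.2) - ∫ x in cell, F (ρ s x) * W x.2
      = ∫ τ in Icc s t, ∫ x in cell, F (ρ τ x) * (u τ x).2 * W' x.2 := by
  have cF : Continuous F := continuous_iff_continuousAt.2 fun r => (hF r).continuousAt
  have cW : Continuous W := continuous_iff_continuousAt.2 fun y => (hW y).continuousAt
  have sub := cell_subset_strip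
  have hsub : Icc s t ×ˢ cell ⊆ Ici 0 ×ˢ strip :=
    prod_mono (fun τ hτ => hs.trans hτ.1) sub
  have cG : ContinuousOn (fun z : ℝ × (ℝ × ℝ) =>
      F' (ρ z.1 z.2) * derivWithin (fun τ => ρ τ z.2) (Ici 0) z.1 * W z.2.2) (Icc s t ×ˢ cell) := by
    have a1 := h.continuousOn_time_deriv.mono hsub
    have a2 : ContinuousOn (fun z : ℝ × (ℝ × ℝ) => F' (ρ z.1 z.2)) (Icc s t ×ˢ cell) :=
      hF'.comp_continuousOn (h.smooth_density.continuousOn.mono hsub)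
    exact (a2.mul a1).mul (Continuous.continuousOn (by fun_prop))
  have slice : ∀ r, 0 ≤ r → ContinuousOn (fun x => F (ρ r x) * W x.2) cell := fun r hr =>
    (cF.comp_continuousOn ((h.contDiffOn_density hr).continuousOn.mono sub)).mul
      (Continuous.continuousOn (by fun_prop))
  rw [← integral_sub (integrableOn_cell (slice t (hs.trans hst))) (integrableOn_cell (slice s hs))]
  have e : ∀ x ∈ cell, F (ρ t x) * W x.2 - F (ρ s x) * W x.2 = ∫ τ in Icc s t,
      F' (ρ τ x) * derivWithin (fun τ => ρ τ x) (Ici 0) τ * W x.2 := by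
    intro x hx
    refine (setIntegral_Icc_deriv (f := fun τ => F (ρ τ x) * W x.2) hst (fun τ hτ => ?_) ?_).symm
    · exact ((hF _).comp_hasDerivWithinAt τ ((h.hasDerivWithinAt_time (hs.trans hτ.1)
        (sub hx)).mono fun r hr => hs.trans hr.1)).mul_const _
    · exact cG.comp (f := fun τ => (τ, x)) (by fun_prop) fun τ hτ => ⟨hτ, hx⟩
  rw [setIntegral_congr_fun measurableSet_cell e, ← integral_integral_swap]
  · exact setIntegral_congr_fun measurableSet_Icc fun τ hτ =>
      h.setIntegral_deriv_mul hF hF' hW hW' (hs.trans hτ.1)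
  · have := cG.integrableOn_compact (isCompact_Icc.prod isCompact_cell) (μ := volume)
    rw [IntegrableOn, Measure.volume_eq_prod, ← Measure.prod_restrict] at this
    exact this

/-- Integrals of functions of the density are conserved. -/
lemma setIntegral_conserved (h : IsGlobalSmoothSolution ρ u p) {F F' : ℝ → ℝ}
    (hF : ∀ r, HasDerivAt F (F' r) r) (hF' : Continuous F') {t : ℝ} (ht : 0 ≤ t) :
    ∫ x in cell, F (ρ t x) = ∫ x in cell, F (ρ 0 x) := by
  have := h.setIntegral_transport_sub hF hF' (W := fun _ => 1) (W' := fun _ => 0)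
    (fun y => hasDerivAt_const y 1) continuous_const le_rfl ht
  simp only [mul_one, mul_zero, integral_zero] at this
  linarith

/-- The velocity is orthogonal to the pressure gradient, which turns the power of gravity into the
dissipation. -/
lemma setIntegral_density_mul_velocity (h : IsGlobalSmoothSolution ρ u p) {t : ℝ} (ht : 0 ≤ t) :
    ∫ x in cell, ρ t x * (u t x).2 = -∫ x in cell, ((u t x).1 ^ 2 + (u t x).2 ^ 2) := by
  have hρ := h.contDiffOn_density ht
  have hu1 := h.contDiffOn_velocity_fst ht
  have hu2 := h.contDiffOn_velocity_snd ht
  have hp := (h.smooth_pressure t ht).smooth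
  have sub := cell_subset_strip
  have c0 := hρ.continuousOn.mono sub
  have c1 := hu1.continuousOn.mono sub
  have c2 := hu2.continuousOn.mono sub
  have c3 := hp.continuousOn.mono sub
  have cd1 := (continuousOn_d1 hp).mono sub
  have cd2 := (continuousOn_d2 hp).mono sub
  have ce1 := (continuousOn_d1 hu1).mono sub
  have ce2 := (continuousOn_d2 hu2).mono sub
  have cg1 : ContinuousOn (fun x => d1 (p t) x * (u t x).1
      + p t x * d1 (fun y => (u t y).1) x) cell := by fun_prop
  have cg2 : ContinuousOn (fun x => d2 (p t) x * (u t x).2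
      + p t x * d2 (fun y => (u t y).2) x) cell := by fun_prop
  have i1 := setIntegral_cell_deriv_fst (f := fun x => p t x * (u t x).1) cg1
    (fun x hx => ((hasDerivAt_d1 hp (sub hx)).mul (hasDerivAt_d1 hu1 (sub hx))).hasDerivWithinAt)
    (fun b hb => by
      simp only [(h.smooth_pressure t ht).periodic.boundary hb,
        (h.periodic_velocity t ht).boundary hb])
  have i2 := setIntegral_cell_deriv_snd (f := fun x => p t x * (u t x).2) cg2
    (fun x hx => (hasDerivWithinAt_d2 hp (sub hx)).mul (hasDerivWithinAt_d2 hu2 (sub hx)))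
    (fun a _ => by simp [h.no_flow t ht a])
  have hsum := integral_add (integrableOn_cell cg1) (integrableOn_cell cg2)
  rw [i1, i2, add_zero] at hsum
  have cu : ContinuousOn (fun x => (u t x).1 ^ 2 + (u t x).2 ^ 2) cell := by fun_prop
  have e : ∀ x ∈ cell, ρ t x * (u t x).2 = -((u t x).1 ^ 2 + (u t x).2 ^ 2) -
      ((d1 (p t) x * (u t x).1 + p t x * d1 (fun y => (u t y).1) x) +
      (d2 (p t) x * (u t x).2 + p t x * d2 (fun y => (u t y).2) x)) := by
    intro x hx
    have t1 := h.darcy_fst t ht x (sub hx)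
    have t2 := h.darcy_snd t ht x (sub hx)
    have t3 := h.incompressible t ht x (sub hx)
    linear_combination (u t x).1 * t1 + (u t x).2 * t2 + p t x * t3
  rw [setIntegral_congr_fun measurableSet_cell e, integral_sub (integrableOn_cell (by fun_prop))
    (integrableOn_cell (by fun_prop)), integral_neg, hsum, sub_zero]

/-- Potential energy is dissipated at the rate `‖u‖²`. -/
lemma potential_energy_sub (h : IsGlobalSmoothSolution ρ u p) {s t : ℝ} (hs : 0 ≤ s)
    (hst : s ≤ t) :
    (∫ x in cell, ρ t x * x.2) - ∫ x in cell, ρ s x * x.2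
      = -∫ τ in Icc s t, ∫ x in cell, ((u τ x).1 ^ 2 + (u τ x).2 ^ 2) := by
  have := h.setIntegral_transport_sub (F := fun r => r) (F' := fun _ => 1) (W := fun y => y)
    (W' := fun _ => 1) hasDerivAt_id continuous_const hasDerivAt_id continuous_const hs hst
  rw [this, ← integral_neg]
  refine setIntegral_congr_fun measurableSet_Icc fun τ hτ => ?_
  simp only [mul_one]
  exact h.setIntegral_density_mul_velocity (hs.trans hτ.1)

lemma potential_energy_bounded (h : IsGlobalSmoothSolution ρ u p) :
    ∃ C, ∀ t, 0 ≤ t → |∫ x in cell, ρ t x * x.2| ≤ C := by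
  refine ⟨(∫ x in cell, ρ 0 x ^ 2) + ∫ x in cell, x.2 ^ 2, fun t ht => ?_⟩
  have c0 := (h.contDiffOn_density ht).continuousOn.mono cell_subset_strip
  have hcons := h.setIntegral_conserved (F := fun r => r ^ 2) (F' := fun r => 2 * r)
    (fun r => by simpa using hasDerivAt_pow 2 r) (by fun_prop) ht
  have c2 : ContinuousOn (fun x : ℝ × ℝ => x.2 ^ 2) cell := by fun_prop
  have ci1 : IntegrableOn (fun x : ℝ × ℝ => ρ t x ^ 2) cell := integrableOn_cell (c0.pow 2)
  rw [← hcons, ← integral_add ci1 (integrableOn_cell c2)]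
  refine (abs_integral_le_integral_abs).trans (setIntegral_mono_on
    (integrableOn_cell (c0.mul continuousOn_snd).abs) (ci1.add (integrableOn_cell c2))
    measurableSet_cell fun x _ => ?_)
  rw [abs_le]
  constructor <;> nlinarith [sq_nonneg (ρ t x + x.2), sq_nonneg (ρ t x - x.2)]

/-- The vorticity equation `curl u = -∂₁ρ` on the Fourier side. It is obtained by pairing Darcy's
law with the rotated gradient of an eigenfunction, which kills the pressure. -/
lemma mul_coeff_density (h : IsGlobalSmoothSolution ρ u p) {t : ℝ} (ht : 0 ≤ t) (k : ℤ) (q : ℕ) :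
    -(k * Complex.I) * coeff (ρ t) k q = (q / 2 : ℝ) * cocoeff (fun x => (u t x).1) k q
      + (k * Complex.I) * coeff (fun x => (u t x).2) k q := by
  have sub := cell_subset_strip
  have hp := (h.smooth_pressure t ht).smooth
  have ofReal_cont : ∀ {f : ℝ × ℝ → ℝ}, ContinuousOn f strip →
      ContinuousOn (fun x => (f x : ℂ)) cell := fun hf =>
    Complex.continuous_ofReal.comp_continuousOn (hf.mono sub)
  have c0 := ofReal_cont (h.contDiffOn_density ht).continuousOn
  have c1 := ofReal_cont (h.contDiffOn_velocity_fst ht).continuousOn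
  have c2 := ofReal_cont (h.contDiffOn_velocity_snd ht).continuousOn
  have c3 := ofReal_cont hp.continuousOn
  have cd1 := ofReal_cont (continuousOn_d1 hp)
  have cd2 := ofReal_cont (continuousOn_d2 hp)
  set e : ℝ → ℂ := fun a => Complex.exp (-(k * a * Complex.I)) with he
  have ce : Continuous e := by simp only [he]; fun_prop
  have cb := continuous_eigenfactor q
  have cb' := continuous_coeigenfactor q
  have hde := hasDerivAt_exp_neg k
  have hper := exp_neg_boundary k
  have cE : ContinuousOn (fun x : ℝ × ℝ => e x.1) cell := (ce.comp continuous_fst).continuousOn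
  have cB : ContinuousOn (fun x : ℝ × ℝ => (eigenfactor q x.2 : ℂ)) cell :=
    Continuous.continuousOn (by fun_prop)
  have cB' : ContinuousOn (fun x : ℝ × ℝ => (coeigenfactor q x.2 : ℂ)) cell :=
    Continuous.continuousOn (by fun_prop)
  have cg1 : ContinuousOn (fun x : ℝ × ℝ => ((d1 (p t) x : ℂ) * e x.1
      + (p t x : ℂ) * (-(k * Complex.I) * e x.1)) * (q / 2 * coeigenfactor q x.2 : ℝ)) cell := by
    push_cast
    exact ((cd1.mul cE).add (c3.mul (continuousOn_const.mul cE))).mul (continuousOn_const.mul cB')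
  have cg2 : ContinuousOn (fun x : ℝ × ℝ => (-(k * Complex.I) * e x.1) * ((d2 (p t) x : ℂ)
      * eigenfactor q x.2 + (p t x : ℂ) * (q / 2 * coeigenfactor q x.2 : ℝ))) cell := by
    push_cast
    exact (continuousOn_const.mul cE).mul ((cd2.mul cB).add (c3.mul (continuousOn_const.mul cB')))
  have i1 := setIntegral_cell_deriv_fst
    (f := fun x => (p t x : ℂ) * e x.1 * (q / 2 * coeigenfactor q x.2 : ℝ)) cg1
    (fun x hx => (((hasDerivAt_d1 hp (sub hx)).ofReal_comp.fun_mul (hde x.1)).mul_const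
      ((q / 2 * coeigenfactor q x.2 : ℝ) : ℂ)).hasDerivWithinAt)
    (fun b hb => by simp only [(h.smooth_pressure t ht).periodic.boundary hb, he, hper])
  have i2 := setIntegral_cell_deriv_snd
    (f := fun x => (-(k * Complex.I) * e x.1) * ((p t x : ℂ) * eigenfactor q x.2)) cg2
    (fun x hx => (((hasDerivWithinAt_d2 hp (sub hx)).ofReal_comp).fun_mul
      (hasDerivAt_eigenfactor q x.2).ofReal_comp.hasDerivWithinAt).const_mul
      (-(k * Complex.I) * e x.1))
    (fun a _ => by simp [eigenfactor_pi, eigenfactor_neg_pi])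
  have j0 : IntegrableOn (fun x => (ρ t x : ℂ) * (e x.1 * eigenfactor q x.2)) cell :=
    integrableOn_cell (c0.mul (cE.mul cB))
  have j1 : IntegrableOn (fun x => ((u t x).1 : ℂ) * (e x.1 * coeigenfactor q x.2)) cell :=
    integrableOn_cell (c1.mul (cE.mul cB'))
  have j2 : IntegrableOn (fun x => ((u t x).2 : ℂ) * (e x.1 * eigenfactor q x.2)) cell :=
    integrableOn_cell (c2.mul (cE.mul cB))
  have hsub := integral_sub (integrableOn_cell cg1) (integrableOn_cell cg2)
  rw [i1, i2, sub_zero] at hsub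
  have hcomb : ∫ x in cell, ((q / 2 : ℝ) * (((u t x).1 : ℂ) * (e x.1 * coeigenfactor q x.2))
      + (k * Complex.I) * (((u t x).2 : ℂ) * (e x.1 * eigenfactor q x.2))
      + (k * Complex.I) * ((ρ t x : ℂ) * (e x.1 * eigenfactor q x.2))) = 0 := by
    rw [← neg_eq_zero, ← integral_neg, ← hsub]
    refine setIntegral_congr_fun measurableSet_cell fun x hx => ?_
    have t1 : ((u t x).1 : ℂ) + d1 (p t) x = 0 := by exact_mod_cast h.darcy_fst t ht x (sub hx)
    have t2 : ((u t x).2 : ℂ) + d2 (p t) x = -ρ t x := by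
      exact_mod_cast h.darcy_snd t ht x (sub hx)
    push_cast
    linear_combination -((q : ℂ) / 2 * (e x.1 * coeigenfactor q x.2)) * t1
      - (k * Complex.I * (e x.1 * eigenfactor q x.2)) * t2
  have j12 : IntegrableOn (fun x => ((q / 2 : ℝ) : ℂ) * (((u t x).1 : ℂ) *
      (e x.1 * coeigenfactor q x.2)) + (k * Complex.I) * (((u t x).2 : ℂ) *
      (e x.1 * eigenfactor q x.2))) cell := (j1.const_mul _).add (j2.const_mul _)
  rw [integral_add j12 (j0.const_mul _), integral_add (j1.const_mul _) (j2.const_mul _),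
    integral_const_mul, integral_const_mul, integral_const_mul] at hcomb
  rw [coeff_eq, coeff_eq, cocoeff]
  linear_combination -((Real.sqrt 2 * Real.pi : ℝ) : ℂ)⁻¹ * hcomb

/-- `u` controls `∂₁ρ` in `Ḣ⁻¹`, mode by mode. -/
lemma sq_mul_sq_coeff_le (h : IsGlobalSmoothSolution ρ u p) {t : ℝ} (ht : 0 ≤ t) (k : ℤ) (q : ℕ) :
    (k : ℝ) ^ 2 * ‖coeff (ρ t) k q‖ ^ 2 ≤ eigenvalue k q *
      (‖cocoeff (fun x => (u t x).1) k q‖ ^ 2 + ‖coeff (fun x => (u t x).2) k q‖ ^ 2) := by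
  have hn := congrArg norm (h.mul_coeff_density ht k q)
  set A := ‖cocoeff (fun x => (u t x).1) k q‖
  set B := ‖coeff (fun x => (u t x).2) k q‖
  have h1 : |(k : ℝ)| * ‖coeff (ρ t) k q‖ ≤ (q / 2 : ℝ) * A + |(k : ℝ)| * B := by
    have h2 := norm_add_le ((q / 2 : ℝ) * cocoeff (fun x => (u t x).1) k q)
      ((k * Complex.I) * coeff (fun x => (u t x).2) k q)
    rw [← hn] at h2
    simp only [norm_mul, norm_neg, Complex.norm_I, mul_one, Complex.norm_intCast,
      Complex.norm_real] at h2
    rwa [Real.norm_of_nonneg (by positivity)] at h2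
  have h3 : (|(k : ℝ)| * ‖coeff (ρ t) k q‖) ^ 2 ≤ ((q / 2 : ℝ) * A + |(k : ℝ)| * B) ^ 2 :=
    pow_le_pow_left₀ (by positivity) h1 2
  rw [mul_pow, sq_abs] at h3
  refine h3.trans ?_
  rw [eigenvalue, ← sq_abs (k : ℝ)]
  nlinarith [sq_nonneg ((q / 2 : ℝ) * B - |(k : ℝ)| * A)]

end IsGlobalSmoothSolution

/-- Differentiation in `x₁` on the Fourier side. -/
lemma coeff_d1 {f : ℝ × ℝ → ℝ} (hf : SmoothOnStrip f) (k : ℤ) (q : ℕ) :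
    coeff (d1 f) k q = (k * Complex.I) * coeff f k q := by
  have sub := cell_subset_strip
  have ofReal_cont : ∀ {f : ℝ × ℝ → ℝ}, ContinuousOn f strip →
      ContinuousOn (fun x => (f x : ℂ)) cell := fun hf =>
    Complex.continuous_ofReal.comp_continuousOn (hf.mono sub)
  have c0 := ofReal_cont hf.smooth.continuousOn
  have cd1 := ofReal_cont (continuousOn_d1 hf.smooth)
  set e : ℝ → ℂ := fun a => Complex.exp (-(k * a * Complex.I)) with he
  have ce : Continuous e := by simp only [he]; fun_prop
  have hde := hasDerivAt_exp_neg k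
  have hper := exp_neg_boundary k
  have cE : ContinuousOn (fun x : ℝ × ℝ => e x.1) cell := (ce.comp continuous_fst).continuousOn
  have cb := continuous_eigenfactor q
  have cB : ContinuousOn (fun x : ℝ × ℝ => (eigenfactor q x.2 : ℂ)) cell :=
    Continuous.continuousOn (by fun_prop)
  have cg : ContinuousOn (fun x : ℝ × ℝ => ((d1 f x : ℂ) * e x.1
      + (f x : ℂ) * (-(k * Complex.I) * e x.1)) * eigenfactor q x.2) cell :=
    ((cd1.mul cE).add (c0.mul (continuousOn_const.mul cE))).mul cB
  have i1 := setIntegral_cell_deriv_fst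
    (f := fun x => (f x : ℂ) * e x.1 * eigenfactor q x.2) cg
    (fun x hx => (((hasDerivAt_d1 hf.smooth (sub hx)).ofReal_comp.fun_mul (hde x.1)).mul_const
      (eigenfactor q x.2 : ℂ)).hasDerivWithinAt)
    (fun b hb => by simp only [hf.periodic.boundary hb, he, hper])
  have j0 : IntegrableOn (fun x => (f x : ℂ) * (e x.1 * eigenfactor q x.2)) cell :=
    integrableOn_cell (c0.mul (cE.mul cB))
  have j1 : IntegrableOn (fun x => (d1 f x : ℂ) * (e x.1 * eigenfactor q x.2)) cell :=
    integrableOn_cell (cd1.mul (cE.mul cB))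
  have hs : ∫ x in cell, ((d1 f x : ℂ) * (e x.1 * eigenfactor q x.2)
      - (k * Complex.I) * ((f x : ℂ) * (e x.1 * eigenfactor q x.2))) = 0 := by
    rw [← i1]
    congr 1
    ext x
    ring
  rw [integral_sub j1 (j0.const_mul _), integral_const_mul] at hs
  rw [coeff_eq, coeff_eq]
  linear_combination ((Real.sqrt 2 * Real.pi : ℝ) : ℂ)⁻¹ * hs

/-! ### Stationary solutions -/

lemma eqOn_zero_of_setIntegral_cell_eq_zero {f : ℝ × ℝ → ℝ} (hf : ContinuousOn f cell)
    (h0 : ∀ x, 0 ≤ f x) (hi : ∫ x in cell, f x = 0) : ∀ x ∈ cell, f x = 0 := by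
  have hae : f =ᵐ[volume.restrict cell] fun _ => (0 : ℝ) :=
    (integral_eq_zero_iff_of_nonneg h0 (integrableOn_cell hf)).1 hi
  refine Measure.eqOn_of_ae_eq hae hf continuousOn_const ?_
  rw [cell, interior_prod_eq, interior_Icc, closure_prod_eq, closure_Ioo neg_pi_lt_pi.ne]

/-- Stationary solutions are at rest. -/
lemma IsStationarySolution.exists_at_rest {ρs : ℝ × ℝ → ℝ} (h : IsStationarySolution ρs) :
    ∃ u p, IsGlobalSmoothSolution (fun _ => ρs) u p ∧ ∀ x ∈ cell, u 0 x = 0 := by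
  obtain ⟨u, p, h⟩ := h
  refine ⟨u, p, h, ?_⟩
  have h1 := h.setIntegral_deriv_mul (F := fun r => r) (F' := fun _ => 1) (W := fun y => y)
    (W' := fun _ => 1) hasDerivAt_id continuous_const hasDerivAt_id continuous_const le_rfl
  have hz : ∀ x, derivWithin (fun _ : ℝ => ρs x) (Ici 0) 0 = 0 := fun x => by
    exact congrFun (derivWithin_const (Ici (0 : ℝ)) (ρs x)) 0
  simp only [hz, mul_one, mul_zero, zero_mul, integral_zero] at h1
  rw [h.setIntegral_density_mul_velocity le_rfl, eq_comm, neg_eq_zero] at h1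
  have c1 := (h.contDiffOn_velocity_fst le_rfl).continuousOn.mono cell_subset_strip
  have c2 := (h.contDiffOn_velocity_snd le_rfl).continuousOn.mono cell_subset_strip
  intro x hx
  have h2 := eqOn_zero_of_setIntegral_cell_eq_zero (by fun_prop) (fun x => by positivity) h1 x hx
  have h3 : (u 0 x).1 ^ 2 = 0 := by nlinarith [sq_nonneg (u 0 x).1, sq_nonneg (u 0 x).2]
  have h4 : (u 0 x).2 ^ 2 = 0 := by nlinarith [sq_nonneg (u 0 x).1, sq_nonneg (u 0 x).2]
  exact Prod.ext (pow_eq_zero_iff two_ne_zero |>.1 h3) (pow_eq_zero_iff two_ne_zero |>.1 h4)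

lemma IsStationarySolution.smoothOnStrip {ρs : ℝ × ℝ → ℝ} (h : IsStationarySolution ρs) :
    SmoothOnStrip ρs := by
  obtain ⟨u, p, h⟩ := h
  exact h.smoothOnStrip le_rfl

/-- Stationary densities are stratified. -/
lemma IsStationarySolution.eq_of_mem_strip {ρs : ℝ × ℝ → ℝ} (h : IsStationarySolution ρs)
    (a : ℝ) {b : ℝ} (hb : b ∈ Icc (-Real.pi) Real.pi) : ρs (a, b) = ρs (0, b) := by
  have hper := h.smoothOnStrip.periodic
  obtain ⟨u, p, h, hu⟩ := h.exists_at_rest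
  have hp := (h.smooth_pressure 0 le_rfl).smooth
  have h0 : (0 : ℝ) ∈ Icc (-Real.pi) Real.pi := ⟨by linarith [Real.pi_pos], Real.pi_pos.le⟩
  have hpc : ∀ a ∈ Icc (-Real.pi) Real.pi, ∀ b ∈ Icc (-Real.pi) Real.pi,
      p 0 (a, b) = p 0 (0, b) := by
    intro a ha b hb
    refine (convex_Icc (-Real.pi) Real.pi).is_const_of_fderivWithin_eq_zero (𝕜 := ℝ)
      (f := fun a => p 0 (a, b)) (fun x _ => ((hasDerivAt_d1 hp
        (mk_mem_strip (a := x) hb)).differentiableAt).differentiableWithinAt) (fun x hx => ?_) ha h0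
    have h1 := h.darcy_fst 0 le_rfl (x, b) (mk_mem_strip hb)
    rw [hu (x, b) ⟨hx, hb⟩] at h1
    have h2 := (hasDerivAt_d1 hp (mk_mem_strip (a := x) hb)).hasDerivWithinAt
      (s := Icc (-Real.pi) Real.pi)
    simp only [Prod.fst_zero, zero_add] at h1
    rw [h1] at h2
    have := h2.hasFDerivWithinAt.fderivWithin (uniqueDiffOn_Icc neg_pi_lt_pi x hx)
    rw [this]
    ext
    simp
  have main : ∀ a ∈ Icc (-Real.pi) Real.pi, ρs (a, b) = ρs (0, b) := by
    intro a ha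
    have h1 := h.darcy_snd 0 le_rfl (a, b) (mk_mem_strip hb)
    have h2 := h.darcy_snd 0 le_rfl (0, b) (mk_mem_strip hb)
    rw [hu (a, b) ⟨ha, hb⟩] at h1
    rw [hu (0, b) ⟨h0, hb⟩] at h2
    have h3 : d2 (p 0) (a, b) = d2 (p 0) (0, b) := by
      refine (uniqueDiffOn_Icc neg_pi_lt_pi b hb).eq_deriv _
        (hasDerivWithinAt_d2 hp (mk_mem_strip (a := a) hb)) ?_
      exact (hasDerivWithinAt_d2 hp (mk_mem_strip (a := 0) hb)).congr
        (fun y hy => hpc a ha y hy) (hpc a ha b hb)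
    linarith
  obtain ⟨a', ha', h1⟩ := hper.exists_mem_Icc a hb
  rw [h1, main a' ha']

/-- A stratified density has no modes with `p ≠ 0`. -/
lemma IsStationarySolution.mul_coeff {ρs : ℝ × ℝ → ℝ} (h : IsStationarySolution ρs)
    (k : ℤ) (q : ℕ) : (k : ℂ) * coeff ρs k q = 0 := by
  obtain ⟨u, p, h, hu⟩ := h.exists_at_rest
  have h1 := h.mul_coeff_density le_rfl k q
  have z1 : cocoeff (fun x => (u 0 x).1) k q = 0 := by
    rw [cocoeff, setIntegral_congr_fun (g := fun _ => 0) measurableSet_cell fun x hx => ?_]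
    · simp
    · simp [hu x hx]
  have z2 : coeff (fun x => (u 0 x).2) k q = 0 := by
    rw [coeff, setIntegral_congr_fun (g := fun _ => 0) measurableSet_cell fun x hx => ?_]
    · simp
    · simp [hu x hx]
  rw [z1, z2, mul_zero, mul_zero, add_zero] at h1
  linear_combination Complex.I * h1 + (k * coeff ρs k q) * Complex.I_sq

lemma coeff_sub {f g : ℝ × ℝ → ℝ} (hf : ContinuousOn f cell) (hg : ContinuousOn g cell) (k : ℤ)
    (q : ℕ) : coeff (fun x => f x - g x) k q = coeff f k q - coeff g k q := by
  have cf : ContinuousOn (fun x => (f x : ℂ)) cell := Complex.continuous_ofReal.comp_continuousOn hf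
  have cg : ContinuousOn (fun x => (g x : ℂ)) cell := Complex.continuous_ofReal.comp_continuousOn hg
  have ce : Continuous fun x : ℝ × ℝ =>
      Complex.exp (-(k * x.1 * Complex.I)) * (eigenfactor q x.2 : ℂ) := by
    have := continuous_eigenfactor q
    fun_prop
  have jf : IntegrableOn (fun x => (f x : ℂ) *
      (Complex.exp (-(k * x.1 * Complex.I)) * (eigenfactor q x.2 : ℂ))) cell :=
    integrableOn_cell (cf.mul ce.continuousOn)
  have jg : IntegrableOn (fun x => (g x : ℂ) *
      (Complex.exp (-(k * x.1 * Complex.I)) * (eigenfactor q x.2 : ℂ))) cell :=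
    integrableOn_cell (cg.mul ce.continuousOn)
  rw [coeff_eq, coeff_eq, coeff_eq, ← mul_sub, ← integral_sub jf jg]
  congr 2
  ext x
  push_cast
  ring

/-! ### Sobolev norms of the deviation from a stratified state -/

lemma eigenvalue_pos (k : ℤ) {q : ℕ} (hq : q ≠ 0) : 0 < eigenvalue k q := by
  have : (0 : ℝ) < q := by exact_mod_cast Nat.pos_of_ne_zero hq
  unfold eigenvalue
  positivity

lemma sq_le_eigenvalue (k : ℤ) (q : ℕ) : (k : ℝ) ^ 2 ≤ eigenvalue k q := by
  unfold eigenvalue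
  linarith [sq_nonneg (q : ℝ)]

lemma homSobolevNorm_sq (s : ℝ) (f : ℝ × ℝ → ℝ) : homSobolevNorm s f ^ 2 =
    ∑' k : ℤ × ℕ, ENNReal.ofReal (eigenvalue k.1 (k.2 + 1) ^ s)
      * ENNReal.ofReal (‖coeff f k.1 (k.2 + 1)‖ ^ 2) := by
  rw [homSobolevNorm, ← ENNReal.rpow_natCast, ← ENNReal.rpow_mul]
  norm_num

/-- Interpolation between the dissipation and a high Sobolev norm: since
`1 ≤ R λ⁻¹ + R⁻ˢ λˢ`, the norm `‖∂₁ρ‖²` is controlled by `R ‖u‖² + R⁻ˢ ‖ρ - ρs‖²` for every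
`R > 0`. -/
lemma IsGlobalSmoothSolution.interpolation {ρ : ℝ → ℝ × ℝ → ℝ} {u : ℝ → ℝ × ℝ → ℝ × ℝ}
    {p : ℝ → ℝ × ℝ → ℝ} (h : IsGlobalSmoothSolution ρ u p) {ρs : ℝ × ℝ → ℝ}
    (hs : IsStationarySolution ρs) {t : ℝ} (ht : 0 ≤ t) {s R : ℝ} (hs0 : 0 < s) (hR : 0 < R) :
    ENNReal.ofReal (∫ x in cell, d1 (ρ t) x ^ 2) ≤
      ENNReal.ofReal (R * ∫ x in cell, ((u t x).1 ^ 2 + (u t x).2 ^ 2))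
        + ENNReal.ofReal (R ^ (-s)) * homSobolevNorm (s + 1) (fun x => ρ t x - ρs x) ^ 2 := by
  have sub := cell_subset_strip
  have c0 := (h.contDiffOn_density ht).continuousOn.mono sub
  have cs := hs.smoothOnStrip.smooth.continuousOn.mono sub
  have c1 := (h.contDiffOn_velocity_fst ht).continuousOn.mono sub
  have c2 := (h.contDiffOn_velocity_snd ht).continuousOn.mono sub
  have cd := (continuousOn_d1 (h.contDiffOn_density ht)).mono sub
  have i1 : IntegrableOn (fun x => (u t x).1 ^ 2) cell := integrableOn_cell (c1.pow 2)
  have i2 : IntegrableOn (fun x => (u t x).2 ^ 2) cell := integrableOn_cell (c2.pow 2)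
  have hu : ∑' k : ℤ × ℕ, ENNReal.ofReal (R *
      (‖cocoeff (fun x => (u t x).1) k.1 (k.2 + 1)‖ ^ 2
        + ‖coeff (fun x => (u t x).2) k.1 (k.2 + 1)‖ ^ 2))
      ≤ ENNReal.ofReal (R * ∫ x in cell, ((u t x).1 ^ 2 + (u t x).2 ^ 2)) := by
    rw [integral_add i1 i2, ENNReal.ofReal_mul hR.le, ENNReal.ofReal_add
      (integral_nonneg fun _ => sq_nonneg _) (integral_nonneg fun _ => sq_nonneg _)]
    simp_rw [ENNReal.ofReal_mul hR.le]
    rw [ENNReal.tsum_mul_left]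
    gcongr
    simp_rw [ENNReal.ofReal_add (sq_nonneg ‖_‖) (sq_nonneg ‖_‖)]
    rw [ENNReal.tsum_add]
    exact add_le_add (tsum_sq_cocoeff_le c1) (tsum_sq_coeff c2).le
  rw [← tsum_sq_coeff cd, homSobolevNorm_sq, ← ENNReal.tsum_mul_left]
  refine le_trans ?_ (add_le_add_left hu _)
  rw [← ENNReal.tsum_add]
  refine ENNReal.tsum_le_tsum fun k => ?_
  set q := k.2 + 1
  have hl := eigenvalue_pos k.1 (q := q) (by omega)
  set l := eigenvalue k.1 q with hldef
  have hkq : (k.1 : ℝ) ^ 2 ≤ l := sq_le_eigenvalue _ _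
  have hc : ‖coeff (d1 (ρ t)) k.1 q‖ ^ 2
      = (k.1 : ℝ) ^ 2 * ‖coeff (fun x => ρ t x - ρs x) k.1 q‖ ^ 2 := by
    have e1 : (k.1 : ℂ) * coeff (ρ t) k.1 q = k.1 * coeff (fun x => ρ t x - ρs x) k.1 q := by
      rw [coeff_sub c0 cs, mul_sub, hs.mul_coeff, sub_zero]
    rw [coeff_d1 (h.smoothOnStrip ht), mul_right_comm, e1]
    simp [mul_pow]
  have hc2 : ‖coeff (d1 (ρ t)) k.1 q‖ ^ 2 = (k.1 : ℝ) ^ 2 * ‖coeff (ρ t) k.1 q‖ ^ 2 := by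
    rw [coeff_d1 (h.smoothOnStrip ht)]
    simp [mul_pow]
  rw [← ENNReal.ofReal_mul (by positivity), ← ENNReal.ofReal_mul (by positivity),
    ← ENNReal.ofReal_add (by positivity) (by positivity)]
  refine ENNReal.ofReal_le_ofReal ?_
  set U := ‖cocoeff (fun x => (u t x).1) k.1 q‖ ^ 2 + ‖coeff (fun x => (u t x).2) k.1 q‖ ^ 2
    with hU
  have hU0 : 0 ≤ U := by positivity
  rcases le_total l R with hlR | hlR
  · have h1 := h.sq_mul_sq_coeff_le ht k.1 q
    rw [← hldef, ← hU, ← hc2] at h1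
    have : l * U ≤ R * U := by gcongr
    have : 0 ≤ R ^ (-s) * (l ^ (s + 1) * ‖coeff (fun x => ρ t x - ρs x) k.1 q‖ ^ 2) := by positivity
    linarith
  · have h2 : 1 ≤ R ^ (-s) * l ^ s := by
      rw [Real.rpow_neg hR.le, inv_mul_eq_div, one_le_div (by positivity)]
      gcongr
    have h3 : l ≤ R ^ (-s) * l ^ (s + 1) := by
      rw [Real.rpow_add_one hl.ne', ← mul_assoc]
      exact le_mul_of_one_le_left hl.le h2
    have : (k.1 : ℝ) ^ 2 * ‖coeff (fun x => ρ t x - ρs x) k.1 q‖ ^ 2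
        ≤ R ^ (-s) * l ^ (s + 1) * ‖coeff (fun x => ρ t x - ρs x) k.1 q‖ ^ 2 := by
      gcongr
      exact hkq.trans h3
    rw [hc]
    nlinarith [mul_nonneg hR.le hU0]

/-! ### Persistence of the horizontal gradient -/

/-- If a density meets the sublevel set `{f ≤ M}` on every horizontal line, then its horizontal
derivative controls the excess over `M`. -/
lemma setIntegral_excess_le {f : ℝ × ℝ → ℝ} (hf : SmoothOnStrip f) {M : ℝ}
    (hM : ∀ b ∈ Icc (-Real.pi) Real.pi, ∃ a, f (a, b) ≤ M) :
    ∫ x in cell, (max (f x - M) 0) ^ 2 ≤ (2 * Real.pi) ^ 2 * ∫ x in cell, d1 f x ^ 2 := by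
  have sub := cell_subset_strip
  have cf := hf.smooth.continuousOn.mono sub
  have cd := (continuousOn_d1 hf.smooth).mono sub
  have cm : ContinuousOn (fun x => (max (f x - M) 0) ^ 2) cell := by fun_prop
  have cd2 : ContinuousOn (fun x => d1 f x ^ 2) cell := cd.pow 2
  rw [setIntegral_cell_swap cm, setIntegral_cell_swap cd2, ← integral_const_mul]
  have fib : ∀ {g : ℝ × ℝ → ℝ}, ContinuousOn g cell →
      IntegrableOn (fun b => ∫ a in Icc (-Real.pi) Real.pi, g (a, b)) (Icc (-Real.pi) Real.pi) := by
    intro g hg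
    have h := integrableOn_cell hg
    rw [IntegrableOn, Measure.volume_eq_prod, cell, ← Measure.prod_restrict] at h
    exact h.integral_prod_right
  refine setIntegral_mono_on (fib cm) ((fib cd2).const_mul _) measurableSet_Icc fun b hb => ?_
  obtain ⟨a0, ha0⟩ := hM b hb
  obtain ⟨a1, ha1, h01⟩ := hf.periodic.exists_mem_Icc a0 hb
  rw [h01] at ha0
  have cdb := continuousOn_slice_fst cd hb
  set D := ∫ a in Icc (-Real.pi) Real.pi, |d1 f (a, b)| with hD
  have pt : ∀ a ∈ Icc (-Real.pi) Real.pi, (max (f (a, b) - M) 0) ^ 2 ≤ D ^ 2 := by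
    intro a ha
    have hD0 : 0 ≤ D := integral_nonneg fun _ => abs_nonneg _
    refine pow_le_pow_left₀ (le_max_right _ _) (max_le ?_ hD0) 2
    have hsub : uIcc a1 a ⊆ Icc (-Real.pi) Real.pi := uIcc_subset_Icc ha1 ha
    have ftc : ∫ r in a1..a, d1 f (r, b) = f (a, b) - f (a1, b) :=
      intervalIntegral.integral_eq_sub_of_hasDerivAt (f := fun r => f (r, b))
        (fun r _ => hasDerivAt_d1 hf.smooth (mk_mem_strip (a := r) hb))
        ((cdb.mono hsub).intervalIntegrable)
    have : f (a, b) - f (a1, b) ≤ D := by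
      rw [← ftc]
      refine (Real.le_norm_self _).trans (intervalIntegral.norm_integral_le_integral_norm_uIoc.trans ?_)
      exact setIntegral_mono_set (cdb.abs.integrableOn_compact isCompact_Icc)
        (Eventually.of_forall fun _ => abs_nonneg _)
        (LE.le.eventuallyLE (uIoc_subset_uIcc.trans hsub))
    linarith
  have h1 : ∫ a in Icc (-Real.pi) Real.pi, (max (f (a, b) - M) 0) ^ 2 ≤ 2 * Real.pi * D ^ 2 := by
    refine (setIntegral_mono_on ((continuousOn_slice_fst cm hb).integrableOn_compact isCompact_Icc)
      (by simp) measurableSet_Icc pt).trans_eq ?_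
    rw [setIntegral_const, Real.volume_real_Icc_of_le neg_pi_lt_pi.le, smul_eq_mul]
    ring
  have h2 := sq_setIntegral_le cdb.abs
  simp only [sq_abs] at h2
  rw [← hD] at h2
  have := Real.pi_pos
  calc _ ≤ 2 * Real.pi * D ^ 2 := h1
    _ ≤ 2 * Real.pi * (2 * Real.pi * ∫ a in Icc (-Real.pi) Real.pi, d1 f (a, b) ^ 2) := by gcongr
    _ = _ := by ring

/-! ### Characteristics -/

lemma eq_of_hasDerivWithinAt_zero {f : ℝ → ℝ} {a b : ℝ}
    (hf : ∀ x ∈ Icc a b, HasDerivWithinAt f 0 (Icc a b) x) {x y : ℝ} (hx : x ∈ Icc a b)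
    (hy : y ∈ Icc a b) : f x = f y := by
  have := (convex_Icc a b).norm_image_sub_le_of_norm_hasDerivWithin_le (C := 0) hf (by simp) hy hx
  rwa [zero_mul, norm_le_zero_iff, sub_eq_zero] at this

/-- The nearest point of `[-π, π]`. -/
def clamp (y : ℝ) : ℝ := max (-Real.pi) (min Real.pi y)

lemma clamp_mem (y : ℝ) : clamp y ∈ Icc (-Real.pi) Real.pi :=
  ⟨le_max_left _ _, max_le neg_pi_lt_pi.le (min_le_left _ _)⟩

lemma clamp_of_mem {y : ℝ} (hy : y ∈ Icc (-Real.pi) Real.pi) : clamp y = y := by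
  rw [clamp, min_eq_right hy.2, max_eq_right hy.1]

lemma clamp_of_ge {y : ℝ} (hy : Real.pi ≤ y) : clamp y = Real.pi := by
  rw [clamp, min_eq_left hy, max_eq_right neg_pi_lt_pi.le]

lemma clamp_of_le {y : ℝ} (hy : y ≤ -Real.pi) : clamp y = -Real.pi := by
  rw [clamp, min_eq_right (hy.trans neg_pi_lt_pi.le), max_eq_left hy]

lemma dist_clamp_le (x y : ℝ) : dist (clamp x) (clamp y) ≤ dist x y := by
  have h : LipschitzWith 1 clamp := (LipschitzWith.id.const_min _).const_max _
  simpa using h.dist_le_mul x y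

namespace IsGlobalSmoothSolution

variable {ρ : ℝ → ℝ × ℝ → ℝ} {u : ℝ → ℝ × ℝ → ℝ × ℝ} {p : ℝ → ℝ × ℝ → ℝ}

/-- The velocity, extended to the plane by its value at the nearest point of the strip. -/
def extVelocity (u : ℝ → ℝ × ℝ → ℝ × ℝ) (τ : ℝ) (x : ℝ × ℝ) : ℝ × ℝ := u τ (x.1, clamp x.2)

lemma exists_norm_extVelocity_le (h : IsGlobalSmoothSolution ρ u p) (T : ℝ) :
    ∃ L : NNReal, ∀ τ ∈ Icc 0 T, ∀ x, ‖extVelocity u τ x‖ ≤ L := by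
  have hsub : Icc 0 T ×ˢ cell ⊆ Ici 0 ×ˢ strip := prod_mono Icc_subset_Ici_self cell_subset_strip
  obtain ⟨C, hC⟩ := (isCompact_Icc.prod isCompact_cell).exists_bound_of_continuousOn
    (h.smooth_velocity.continuousOn.mono hsub)
  refine ⟨C.toNNReal, fun τ hτ x => ?_⟩
  obtain ⟨a, ha, hax⟩ := (h.periodic_velocity τ hτ.1).exists_mem_Icc x.1 (clamp_mem x.2)
  rw [extVelocity, hax]
  exact (hC (τ, (a, clamp x.2)) ⟨hτ, ha, clamp_mem _⟩).trans (Real.le_coe_toNNReal C)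

lemma exists_lipschitz_extVelocity (h : IsGlobalSmoothSolution ρ u p) (T A b : ℝ) :
    ∃ K : NNReal, ∀ τ ∈ Icc 0 T, LipschitzOnWith K (extVelocity u τ)
      (Metric.closedBall ((0 : ℝ), b) A) := by
  have hsub : Icc 0 T ×ˢ (Icc (-A) A ×ˢ Icc (-Real.pi) Real.pi) ⊆ Ici 0 ×ˢ strip :=
    prod_mono Icc_subset_Ici_self (prod_mono (subset_univ _) subset_rfl)
  obtain ⟨K, hK⟩ := (h.smooth_velocity.mono hsub).exists_lipschitzOnWith (by simp)
    ((convex_Icc _ _).prod ((convex_Icc _ _).prod (convex_Icc _ _)))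
    (isCompact_Icc.prod (isCompact_Icc.prod isCompact_Icc))
  have mem : ∀ x ∈ Metric.closedBall ((0 : ℝ), b) A, x.1 ∈ Icc (-A) A := by
    intro x hx
    have h1 : dist x.1 0 ≤ A := (le_max_left _ _).trans (Metric.mem_closedBall.1 hx)
    rwa [Real.dist_eq, sub_zero, abs_le] at h1
  refine ⟨K, fun τ hτ => LipschitzOnWith.of_dist_le_mul fun x hx y hy => ?_⟩
  refine (hK.dist_le_mul (τ, (x.1, clamp x.2)) ⟨hτ, mem x hx, clamp_mem _⟩
    (τ, (y.1, clamp y.2)) ⟨hτ, mem y hy, clamp_mem _⟩).trans ?_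
  gcongr
  simp only [Prod.dist_eq, dist_self]
  exact max_le (le_max_of_le_left dist_nonneg) (max_le_max le_rfl (dist_clamp_le _ _))

/-- The density is constant along the trajectories of the velocity. -/
lemma density_eq_along (h : IsGlobalSmoothSolution ρ u p) {T : ℝ} {X : ℝ → ℝ × ℝ}
    (hT : 0 ≤ T) (hX : ∀ τ ∈ Icc 0 T, HasDerivWithinAt X (u τ (X τ)) (Icc 0 T) τ)
    (hmem : ∀ τ ∈ Icc 0 T, X τ ∈ strip) : ρ T (X T) = ρ 0 (X 0) := by
  refine eq_of_hasDerivWithinAt_zero (f := fun τ => ρ τ (X τ)) (a := 0) (b := T)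
    (fun τ hτ => ?_) ⟨hT, le_rfl⟩ ⟨le_rfl, hT⟩
  have hx := hmem τ hτ
  have hz : (τ, X τ) ∈ Ici (0 : ℝ) ×ˢ strip := ⟨hτ.1, hx⟩
  have hD := (h.smooth_density.differentiableOn (by simp) _ hz).hasFDerivWithinAt
  set D := fderivWithin ℝ (fun z : ℝ × (ℝ × ℝ) => ρ z.1 z.2) (Ici 0 ×ˢ strip) (τ, X τ)
  have e1 : D (1, 0) = derivWithin (fun r => ρ r (X τ)) (Ici 0) τ := by
    have h2 : HasDerivWithinAt (fun r : ℝ => (r, X τ)) ((1 : ℝ), (0 : ℝ × ℝ)) (Ici 0) τ :=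
      (hasDerivWithinAt_id _ _).prodMk (hasDerivWithinAt_const _ _ _)
    have hm : MapsTo (fun r : ℝ => (r, X τ)) (Ici 0) (Ici 0 ×ˢ strip) := fun r hr => ⟨hr, hx⟩
    exact ((hD.comp_hasDerivWithinAt τ h2 hm).derivWithin (uniqueDiffOn_Ici 0 _ hτ.1)).symm
  have e2 : ∀ v, D (0, v) = fderivWithin ℝ (ρ τ) strip (X τ) v := by
    intro v
    have h2 : HasFDerivWithinAt (fun y : ℝ × ℝ => (τ, y))
        (ContinuousLinearMap.inr ℝ ℝ (ℝ × ℝ)) strip (X τ) :=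
      (hasFDerivAt_prodMk_right τ (X τ)).hasFDerivWithinAt
    have hm : MapsTo (fun y : ℝ × ℝ => (τ, y)) strip (Ici 0 ×ˢ strip) := fun y hy => ⟨hτ.1, hy⟩
    have h3 : HasFDerivWithinAt (ρ τ) (D.comp (ContinuousLinearMap.inr ℝ ℝ (ℝ × ℝ))) strip (X τ) :=
      hD.comp (X τ) h2 hm
    rw [h3.fderivWithin (uniqueDiffOn_strip _ hx)]
    simp
  have hc : HasDerivWithinAt (fun r => (r, X r)) ((1 : ℝ), u τ (X τ)) (Icc 0 T) τ :=
    (hasDerivWithinAt_id _ _).prodMk (hX τ hτ)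
  have hm : MapsTo (fun r : ℝ => (r, X r)) (Icc 0 T) (Ici 0 ×ˢ strip) :=
    fun r hr => ⟨hr.1, hmem r hr⟩
  refine (hD.comp_hasDerivWithinAt τ hc hm).congr_deriv ?_
  have split : ((1 : ℝ), u τ (X τ)) = ((1 : ℝ), (0 : ℝ × ℝ)) + (((u τ (X τ)).1 •
      ((0 : ℝ), ((1 : ℝ), (0 : ℝ)))) + ((u τ (X τ)).2 • ((0 : ℝ), ((0 : ℝ), (1 : ℝ))))) := by
    ext <;> simp
  rw [split, map_add, map_add, map_smul, map_smul, e1, e2, e2]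
  exact h.transport τ hτ.1 (X τ) hx

/-- Trajectories of the extended velocity that are in the strip at the final time never leave it:
outside of the strip the extended velocity is horizontal. -/
lemma mem_strip_of_trajectory (h : IsGlobalSmoothSolution ρ u p) {T : ℝ} {X : ℝ → ℝ × ℝ}
    (hT : 0 ≤ T) (hX : ∀ τ ∈ Icc 0 T, HasDerivWithinAt X (extVelocity u τ (X τ)) (Icc 0 T) τ)
    (hXT : X T ∈ strip) : ∀ τ ∈ Icc 0 T, X τ ∈ strip := by
  have hX2 : ∀ τ ∈ Icc 0 T,
      HasDerivWithinAt (fun r => (X r).2) (extVelocity u τ (X τ)).2 (Icc 0 T) τ :=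
    fun τ hτ => (hX τ hτ).snd
  rw [mem_strip] at hXT
  -- the squared excess over either wall has zero derivative
  have up : ∀ τ ∈ Icc 0 T, (max ((X τ).2 - Real.pi) 0) ^ 2 = 0 := by
    intro τ hτ
    rw [eq_of_hasDerivWithinAt_zero (f := fun τ => (max ((X τ).2 - Real.pi) 0) ^ 2) (a := 0)
      (b := T) (fun r hr => ?_) hτ ⟨hT, le_rfl⟩, max_eq_right (by linarith [hXT.2])]
    · norm_num
    · refine ((hasDerivAt_posPart_sq Real.pi (X r).2).comp_hasDerivWithinAt r
        (hX2 r hr)).congr_deriv ?_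
      rcases le_total (X r).2 Real.pi with hle | hle
      · rw [max_eq_right (by linarith)]; ring
      · rw [extVelocity, clamp_of_ge hle, (h.no_flow r hr.1 _).1, mul_zero]
  have down : ∀ τ ∈ Icc 0 T, (max (-(X τ).2 - Real.pi) 0) ^ 2 = 0 := by
    intro τ hτ
    rw [eq_of_hasDerivWithinAt_zero (f := fun τ => (max (-(X τ).2 - Real.pi) 0) ^ 2) (a := 0)
      (b := T) (fun r hr => ?_) hτ ⟨hT, le_rfl⟩, max_eq_right (by linarith [hXT.1])]
    · norm_num
    · refine ((hasDerivAt_posPart_sq Real.pi (-(X r).2)).comp_hasDerivWithinAt r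
        (hX2 r hr).fun_neg).congr_deriv ?_
      rcases le_total (-Real.pi) (X r).2 with hle | hle
      · rw [max_eq_right (by linarith)]; ring
      · rw [extVelocity, clamp_of_le hle, (h.no_flow r hr.1 _).2, neg_zero, mul_zero]
  intro τ hτ
  have h1 := (pow_eq_zero_iff two_ne_zero).1 (up τ hτ)
  have h2 := (pow_eq_zero_iff two_ne_zero).1 (down τ hτ)
  rw [mem_strip]
  exact ⟨by linarith [le_max_left (-(X τ).2 - Real.pi) 0],
    by linarith [le_max_left ((X τ).2 - Real.pi) 0]⟩

/-- On every horizontal line and at every time, the density attains one of the values it had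
initially on the vertical line `x₁ = π`. Indeed the back-to-labels map of the lifted strip moves
points a bounded distance, so that the first component of the image of a horizontal line is all
of `ℝ`. -/
lemma exists_density_eq_initial (h : IsGlobalSmoothSolution ρ u p) {T : ℝ} (hT : 0 ≤ T) {b : ℝ}
    (hb : b ∈ Icc (-Real.pi) Real.pi) :
    ∃ a, ∃ y ∈ Icc (-Real.pi) Real.pi, ρ T (a, b) = ρ 0 (Real.pi, y) := by
  obtain ⟨L, hL⟩ := h.exists_norm_extVelocity_le T
  lift T to NNReal using hT
  -- starting points `(a, b)` with `|a| ≤ r` suffice, since displacements are at most `L T`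
  set r : NNReal := L * T + Real.toNNReal Real.pi with hr
  have hrval : (r : ℝ) = L * T + Real.pi := by
    rw [hr]; push_cast; rw [Real.coe_toNNReal _ Real.pi_pos.le]
  obtain ⟨K, hK⟩ := h.exists_lipschitz_extVelocity T (L * T + r : NNReal) b
  have hPL : IsPicardLindelof (extVelocity u) (tmin := 0) (tmax := T)
      ⟨(T : ℝ), T.coe_nonneg, le_rfl⟩ ((0 : ℝ), b) (L * T + r) r L K := by
    refine ⟨hK, fun x _ => ?_, fun τ hτ x _ => hL τ hτ x, ?_⟩
    · exact h.smooth_velocity.continuousOn.comp (f := fun τ : ℝ => (τ, (x.1, clamp x.2)))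
        (by fun_prop) fun τ hτ => ⟨hτ.1, mk_mem_strip (clamp_mem _)⟩
    · simp
  obtain ⟨α, hα, hαc⟩ :=
    hPL.exists_forall_mem_closedBall_eq_hasDerivWithinAt_continuousOn
  have hball : ∀ a ∈ Icc (-(r : ℝ)) r, (a, b) ∈ Metric.closedBall ((0 : ℝ), b) r := by
    intro a ha
    rw [Metric.mem_closedBall, Prod.dist_eq]
    simpa [abs_le] using ha
  have h0 : (0 : ℝ) ∈ Icc 0 (T : ℝ) := ⟨le_rfl, T.coe_nonneg⟩
  have hTT : (T : ℝ) ∈ Icc 0 (T : ℝ) := ⟨T.coe_nonneg, le_rfl⟩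
  have disp : ∀ a ∈ Icc (-(r : ℝ)) r, |(α ((a, b), 0)).1 - a| ≤ L * T := by
    intro a ha
    have h1 := (convex_Icc 0 (T : ℝ)).norm_image_sub_le_of_norm_hasDerivWithin_le
      (C := (L : ℝ)) (fun τ hτ => (hα _ (hball a ha)).2 τ hτ) (fun τ hτ => hL τ hτ _) hTT h0
    rw [(hα _ (hball a ha)).1] at h1
    refine (norm_fst_le (α ((a, b), 0) - (a, b))).trans (h1.trans_eq ?_)
    simp
  have hc : ContinuousOn (fun a => (α ((a, b), 0)).1) (Icc (-(r : ℝ)) r) := by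
    refine continuous_fst.comp_continuousOn (hαc.comp (f := fun a : ℝ => ((a, b), (0 : ℝ)))
      (by fun_prop) fun a ha => ⟨hball a ha, h0⟩)
  have hr0 : -(r : ℝ) ≤ r := neg_le_self r.coe_nonneg
  have hpi := Real.pi_pos
  obtain ⟨a, ha, hval⟩ : Real.pi ∈ (fun a => (α ((a, b), 0)).1) '' Icc (-(r : ℝ)) r := by
    refine intermediate_value_Icc hr0 hc ⟨?_, ?_⟩
    · have := (abs_le.1 (disp (-r) ⟨le_rfl, hr0⟩)).2
      linarith
    · have := (abs_le.1 (disp r ⟨hr0, le_rfl⟩)).1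
      linarith
  obtain ⟨hend, hder⟩ := hα _ (hball a ha)
  simp only at hend hval
  have hstrip := h.mem_strip_of_trajectory T.coe_nonneg hder (by
    rw [hend]; exact mk_mem_strip hb)
  have hder' : ∀ τ ∈ Icc 0 (T : ℝ), HasDerivWithinAt (fun s => α ((a, b), s))
      (u τ (α ((a, b), τ))) (Icc 0 (T : ℝ)) τ := by
    intro τ hτ
    have h1 := hder τ hτ
    rwa [extVelocity, clamp_of_mem (mem_strip.1 (hstrip τ hτ))] at h1
  have key := h.density_eq_along T.coe_nonneg hder' hstrip
  refine ⟨a, (α ((a, b), 0)).2, mem_strip.1 (hstrip 0 h0), ?_⟩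
  rw [hend] at key
  rw [key, ← hval]

end IsGlobalSmoothSolution

/-! ### Bumps of unit slope -/

/-- A smooth even cutoff on the line, with value `1` at the origin and support `[-1, 1]`. -/
def cutoff (x : ℝ) : ℝ := Real.smoothTransition (1 - x ^ 2)

lemma contDiff_cutoff : ContDiff ℝ ∞ cutoff :=
  Real.smoothTransition.contDiff.comp (by fun_prop)

lemma cutoff_zero : cutoff 0 = 1 := by simp [cutoff]

lemma cutoff_neg (x : ℝ) : cutoff (-x) = cutoff x := by simp [cutoff]

lemma cutoff_of_one_le {x : ℝ} (hx : 1 ≤ |x|) : cutoff x = 0 := by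
  refine Real.smoothTransition.zero_of_nonpos ?_
  rw [← sq_abs]
  nlinarith

lemma hasCompactSupport_cutoff : HasCompactSupport cutoff := by
  refine HasCompactSupport.intro (isCompact_Icc (a := -1) (b := 1)) fun x hx => ?_
  refine cutoff_of_one_le ?_
  by_contra! h
  exact hx ⟨(abs_lt.1 h).1.le, (abs_lt.1 h).2.le⟩

lemma contDiff_deriv_cutoff : ContDiff ℝ ∞ (deriv cutoff) :=
  (contDiff_infty_iff_deriv.1 contDiff_cutoff).2

lemma continuous_deriv_deriv_cutoff : Continuous (deriv (deriv cutoff)) :=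
  contDiff_deriv_cutoff.continuous_deriv (by simp)

lemma hasDerivAt_cutoff (x : ℝ) : HasDerivAt cutoff (deriv cutoff x) x :=
  (contDiff_cutoff.differentiable (by simp) x).hasDerivAt

lemma hasDerivAt_deriv_cutoff (x : ℝ) :
    HasDerivAt (deriv cutoff) (deriv (deriv cutoff) x) x :=
  (contDiff_deriv_cutoff.differentiable (by simp) x).hasDerivAt

lemma deriv_eq_zero_outside {f : ℝ → ℝ} (hf : ∀ x, 1 < |x| → f x = 0) {x : ℝ} (hx : 1 < |x|) :
    deriv f x = 0 := by
  have : f =ᶠ[nhds x] fun _ => 0 := by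
    filter_upwards [(continuous_abs.isOpen_preimage _ isOpen_Ioi).mem_nhds hx] with y hy
    exact hf y hy
  rw [this.deriv_eq, deriv_const]

lemma exists_cutoff_bound : ∃ C, 0 ≤ C ∧ ∀ x, |cutoff x| ≤ C ∧ |deriv cutoff x| ≤ C ∧
    |deriv (deriv cutoff) x| ≤ C := by
  obtain ⟨C0, h0⟩ := hasCompactSupport_cutoff.exists_bound_of_continuous contDiff_cutoff.continuous
  obtain ⟨C1, h1⟩ := hasCompactSupport_cutoff.deriv.exists_bound_of_continuous
    contDiff_deriv_cutoff.continuous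
  obtain ⟨C2, h2⟩ := hasCompactSupport_cutoff.deriv.deriv.exists_bound_of_continuous
    continuous_deriv_deriv_cutoff
  refine ⟨max C0 (max C1 C2), (norm_nonneg _).trans ((h0 0).trans (le_max_left _ _)),
    fun x => ⟨(h0 x).trans (le_max_left _ _), ?_, ?_⟩⟩
  · exact (h1 x).trans ((le_max_left _ _).trans (le_max_right _ _))
  · exact (h2 x).trans ((le_max_right _ _).trans (le_max_right _ _))

/-- Two integrations by parts in each variable: on a product `a(x₁) b(x₂)` with `a` periodic and
`b` vanishing on the walls, `-Δ` acts on the coefficients as multiplication by the eigenvalue. -/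
lemma coeff_laplacian {a a' a'' b b' b'' : ℝ → ℝ} (ha : ∀ x, HasDerivAt a (a' x) x)
    (ha' : ∀ x, HasDerivAt a' (a'' x) x) (ha'' : Continuous a'')
    (hb : ∀ x, HasDerivAt b (b' x) x) (hb' : ∀ x, HasDerivAt b' (b'' x) x) (hb'' : Continuous b'')
    (pa : a Real.pi = a (-Real.pi)) (pa' : a' Real.pi = a' (-Real.pi))
    (zb : b Real.pi = 0) (zb' : b (-Real.pi) = 0) (k : ℤ) (q : ℕ) :
    coeff (fun x => a'' x.1 * b x.2 + a x.1 * b'' x.2) k q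
      = -(eigenvalue k q * coeff (fun x => a x.1 * b x.2) k q) := by
  have ca : Continuous a := continuous_iff_continuousAt.2 fun x => (ha x).continuousAt
  have cb : Continuous b := continuous_iff_continuousAt.2 fun x => (hb x).continuousAt
  have cB := continuous_eigenfactor q
  set e : ℝ → ℂ := fun a => Complex.exp (-(k * a * Complex.I)) with he
  have ce : Continuous e := by simp only [he]; fun_prop
  have hde : ∀ x, HasDerivAt e (-(k * Complex.I) * e x) x := hasDerivAt_exp_neg k
  have hper : e Real.pi = e (-Real.pi) := exp_neg_boundary k
  have c1 : Continuous fun x : ℝ × ℝ => ((a'' x.1 : ℂ) * e x.1 + (k : ℂ) ^ 2 * (a x.1 * e x.1))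
      * (b x.2 * eigenfactor q x.2 : ℝ) := by fun_prop
  have c2 : Continuous fun x : ℝ × ℝ => ((a x.1 : ℂ) * e x.1) *
      ((b'' x.2 * eigenfactor q x.2 + (q / 2) ^ 2 * (b x.2 * eigenfactor q x.2) : ℝ) : ℂ) := by
    fun_prop
  have i1 := setIntegral_cell_deriv_fst (f := fun x => ((a' x.1 : ℂ) * e x.1
      + (k * Complex.I) * (a x.1 * e x.1)) * (b x.2 * eigenfactor q x.2 : ℝ)) c1.continuousOn
    (fun x _ => by
      have h1 := ((ha' x.1).ofReal_comp.fun_mul (hde x.1)).fun_add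
        (((ha x.1).ofReal_comp.fun_mul (hde x.1)).const_mul (k * Complex.I))
      refine ((h1.congr_deriv ?_).mul_const ((b x.2 * eigenfactor q x.2 : ℝ) : ℂ)).hasDerivWithinAt
      linear_combination -((k : ℂ) ^ 2 * (a x.1 * e x.1)) * Complex.I_sq)
    (fun y _ => by simp only [hper, pa, pa'])
  have i2 := setIntegral_cell_deriv_snd (f := fun x => ((a x.1 : ℂ) * e x.1) *
      ((b' x.2 * eigenfactor q x.2 - b x.2 * (q / 2 * coeigenfactor q x.2) : ℝ) : ℂ))
      c2.continuousOn
    (fun x _ => by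
      have h1 := ((hb' x.2).fun_mul (hasDerivAt_eigenfactor q x.2)).fun_sub
        ((hb x.2).fun_mul ((hasDerivAt_coeigenfactor q x.2).const_mul (q / 2 : ℝ)))
      refine ((h1.congr_deriv ?_).ofReal_comp.const_mul ((a x.1 : ℂ) * e x.1)).hasDerivWithinAt
      ring)
    (fun y _ => by simp [eigenfactor_pi, eigenfactor_neg_pi, zb, zb'])
  have hsum := integral_add (integrableOn_cell c1.continuousOn) (integrableOn_cell c2.continuousOn)
  rw [i1, i2, add_zero] at hsum
  have c3 : Continuous fun x : ℝ × ℝ => ((a'' x.1 * b x.2 + a x.1 * b'' x.2 : ℝ) : ℂ) *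
      (e x.1 * eigenfactor q x.2) := by fun_prop
  have c4 : Continuous fun x : ℝ × ℝ => (eigenvalue k q : ℂ) * (((a x.1 * b x.2 : ℝ) : ℂ) *
      (e x.1 * eigenfactor q x.2)) := by fun_prop
  have hs : ∫ x in cell, (((a'' x.1 * b x.2 + a x.1 * b'' x.2 : ℝ) : ℂ) *
      (e x.1 * eigenfactor q x.2) + (eigenvalue k q : ℂ) * (((a x.1 * b x.2 : ℝ) : ℂ) *
      (e x.1 * eigenfactor q x.2))) = 0 := by
    rw [← hsum]
    congr 1
    ext x
    rw [eigenvalue]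
    push_cast
    ring
  rw [integral_add (integrableOn_cell c3.continuousOn) (integrableOn_cell c4.continuousOn),
    integral_const_mul] at hs
  rw [coeff_eq, coeff_eq]
  linear_combination ((Real.sqrt 2 * Real.pi : ℝ) : ℂ)⁻¹ * hs

/-- Away from the endpoint exponent, `λ^{2-γ}` is an arbitrarily small multiple of `λ²` plus a
constant. -/
lemma exists_rpow_le {γ κ : ℝ} (hγ : 0 < γ) (hκ : 0 < κ) :
    ∃ C, 0 ≤ C ∧ ∀ l : ℝ, 1 / 4 ≤ l → l ^ (2 - γ) ≤ κ * l ^ 2 + C := by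
  obtain ⟨Λ, hΛ⟩ := ((tendsto_rpow_neg_atTop hγ).eventually (gt_mem_nhds hκ)).exists_forall_of_atTop
  obtain ⟨C, hC⟩ := (isCompact_Icc (a := (1 / 4 : ℝ)) (b := Λ)).exists_bound_of_continuousOn
    (f := fun l : ℝ => l ^ (2 - γ)) (ContinuousOn.rpow_const continuousOn_id fun l hl =>
      Or.inl (lt_of_lt_of_le (by norm_num) hl.1).ne')
  refine ⟨max C 0, le_max_right _ _, fun l hl => ?_⟩
  have hl0 : 0 < l := by linarith
  rcases le_total l Λ with h | h
  · have h1 := (le_abs_self _).trans (hC l ⟨hl, h⟩)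
    have := le_max_left C 0
    have : 0 ≤ κ * l ^ 2 := by positivity
    linarith
  · have h1 : l ^ (2 - γ) = l ^ 2 * l ^ (-γ) := by
      rw [← Real.rpow_natCast l 2, ← Real.rpow_add hl0]
      norm_num [sub_eq_add_neg]
    have h2 : l ^ 2 * l ^ (-γ) ≤ l ^ 2 * κ := by
      gcongr
      exact (hΛ l h).le
    linarith [le_max_right C 0]

/-- Interpolation of `H^{2-γ}` between `L²` and the domain of the Dirichlet Laplacian. Here `g`
plays the role of `Δβ`. -/
lemma sobolevNorm_le {β g : ℝ × ℝ → ℝ} (cβ : Continuous β) (cg : Continuous g)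
    (hg : ∀ k q, coeff g k q = -(eigenvalue k q * coeff β k q)) {γ κ C : ℝ} (hC : 0 ≤ C)
    (hκ : 0 ≤ κ) (hγ : ∀ l : ℝ, 1 / 4 ≤ l → l ^ (2 - γ) ≤ κ * l ^ 2 + C) {ε : ℝ} (hε : 0 ≤ ε)
    (hbound : κ * (∫ x in cell, g x ^ 2) + (C + 1) * ∫ x in cell, β x ^ 2 ≤ ε ^ 2) :
    sobolevNorm (2 - γ) β ≤ ENNReal.ofReal ε := by
  have hL2 : eLpNorm β 2 (volume.restrict cell) ^ 2 = ENNReal.ofReal (∫ x in cell, β x ^ 2) := by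
    have hm : MemLp β 2 (volume.restrict cell) :=
      (memLp_two_iff_integrable_sq (cβ.aestronglyMeasurable)).2
        (integrableOn_cell (cβ.pow 2).continuousOn)
    rw [hm.eLpNorm_eq_integral_rpow_norm (by norm_num) (by norm_num), ← ENNReal.ofReal_pow
      (by positivity)]
    congr 1
    simp only [ENNReal.toReal_ofNat, Real.rpow_ofNat, Real.norm_eq_abs, sq_abs]
    rw [← Real.rpow_natCast, ← Real.rpow_mul (integral_nonneg fun _ => sq_nonneg _)]
    norm_num
  have hhom : homSobolevNorm (2 - γ) β ^ 2 ≤ ENNReal.ofReal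
      (κ * (∫ x in cell, g x ^ 2) + C * ∫ x in cell, β x ^ 2) := by
    have ig : 0 ≤ ∫ x in cell, g x ^ 2 := integral_nonneg fun _ => sq_nonneg _
    have iβ : 0 ≤ ∫ x in cell, β x ^ 2 := integral_nonneg fun _ => sq_nonneg _
    rw [homSobolevNorm_sq, ENNReal.ofReal_add (by positivity) (by positivity),
      ENNReal.ofReal_mul hκ, ENNReal.ofReal_mul hC, ← tsum_sq_coeff cg.continuousOn,
      ← tsum_sq_coeff cβ.continuousOn, ← ENNReal.tsum_mul_left, ← ENNReal.tsum_mul_left,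
      ← ENNReal.tsum_add]
    refine ENNReal.tsum_le_tsum fun k => ?_
    set q := k.2 + 1 with hq
    have hl : 1 / 4 ≤ eigenvalue k.1 q := by
      have : (1 : ℝ) ≤ q := by rw [hq]; push_cast; linarith [Nat.cast_nonneg (α := ℝ) k.2]
      unfold eigenvalue
      nlinarith [sq_nonneg (k.1 : ℝ)]
    have hl0 : 0 ≤ eigenvalue k.1 q := by linarith
    rw [← ENNReal.ofReal_mul (by positivity), ← ENNReal.ofReal_mul hκ, ← ENNReal.ofReal_mul hC,
      ← ENNReal.ofReal_add (by positivity) (by positivity)]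
    refine ENNReal.ofReal_le_ofReal ?_
    rw [hg, norm_neg, norm_mul, Complex.norm_real, Real.norm_of_nonneg hl0, mul_pow]
    have := mul_le_mul_of_nonneg_right (hγ _ hl) (sq_nonneg ‖coeff β k.1 q‖)
    linarith
  have hX : homSobolevNorm (2 - γ) β ^ 2 + eLpNorm β 2 (volume.restrict cell) ^ 2
      ≤ ENNReal.ofReal ε ^ 2 := by
    have ig : 0 ≤ ∫ x in cell, g x ^ 2 := integral_nonneg fun _ => sq_nonneg _
    have iβ : 0 ≤ ∫ x in cell, β x ^ 2 := integral_nonneg fun _ => sq_nonneg _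
    rw [hL2, ← ENNReal.ofReal_pow hε]
    refine (add_le_add_left hhom _).trans ?_
    rw [← ENNReal.ofReal_add (by positivity) iβ]
    exact ENNReal.ofReal_le_ofReal (by linarith)
  rw [sobolevNorm]
  refine (ENNReal.rpow_le_rpow hX (by norm_num)).trans_eq ?_
  rw [← ENNReal.rpow_natCast, ← ENNReal.rpow_mul]
  norm_num

/-- A function bounded by `B` that is supported, within the cell, in a rectangle of sides `2πδ` and
`2δ`. -/
lemma setIntegral_sq_le_of_support {g : ℝ × ℝ → ℝ} (cg : Continuous g) {B δ y : ℝ}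
    (hδ : 0 ≤ δ) (hB : ∀ x, |g x| ≤ B)
    (hs : ∀ x ∈ cell, x ∉ Icc (-(Real.pi * δ)) (Real.pi * δ) ×ˢ Icc (y - δ) (y + δ) → g x = 0) :
    ∫ x in cell, g x ^ 2 ≤ B ^ 2 * (4 * Real.pi * δ ^ 2) := by
  set Q := Icc (-(Real.pi * δ)) (Real.pi * δ) ×ˢ Icc (y - δ) (y + δ) with hQ
  have hpi := Real.pi_pos
  have hQm : MeasurableSet Q := measurableSet_Icc.prod measurableSet_Icc
  have hQc : IsCompact Q := isCompact_Icc.prod isCompact_Icc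
  have hvol : volume.real Q = 4 * Real.pi * δ ^ 2 := by
    rw [hQ, Measure.real, Measure.volume_eq_prod, Measure.prod_prod, ENNReal.toReal_mul,
      ← Measure.real, ← Measure.real, Real.volume_real_Icc_of_le (by nlinarith),
      Real.volume_real_Icc_of_le (by linarith)]
    ring
  have hint : IntegrableOn (fun x => g x ^ 2) Q := (cg.pow 2).continuousOn.integrableOn_compact hQc
  calc ∫ x in cell, g x ^ 2 ≤ ∫ x in cell, Q.indicator (fun x => g x ^ 2) x := by
        refine setIntegral_mono_on (integrableOn_cell (cg.pow 2).continuousOn)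
          ((integrable_indicator_iff hQm).2 hint).integrableOn measurableSet_cell fun x hx => ?_
        by_cases hxQ : x ∈ Q
        · rw [indicator_of_mem hxQ]
        · rw [indicator_of_notMem hxQ, hs x hx hxQ]; norm_num
    _ ≤ ∫ x, Q.indicator (fun x => g x ^ 2) x :=
        setIntegral_le_integral ((integrable_indicator_iff hQm).2 hint)
          (Eventually.of_forall fun x => indicator_nonneg (fun _ _ => sq_nonneg _) x)
    _ = ∫ x in Q, g x ^ 2 := integral_indicator hQm
    _ ≤ ∫ x in Q, B ^ 2 := by
        refine setIntegral_mono_on hint (by simp [hQc.measure_lt_top]) hQm fun x _ => ?_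
        rw [← sq_abs]
        exact pow_le_pow_left₀ (abs_nonneg _) (hB x) 2
    _ = B ^ 2 * (4 * Real.pi * δ ^ 2) := by
        rw [setIntegral_const, hvol, smul_eq_mul, mul_comm]

/-- Periodic bumps of height `A δ` and width `δ`, supported away from `x₁ = π`. Their slope is of
order one, so that their Laplacians are bounded in `L²` uniformly in `δ`. -/
lemma exists_bump (A : ℝ) : ∃ E D : ℝ, 0 ≤ E ∧ 0 ≤ D ∧ ∀ δ y : ℝ, 0 < δ → δ ≤ 1 →
    δ ≤ |Real.pi - y| → δ ≤ |-Real.pi - y| → ∃ β g : ℝ × ℝ → ℝ, ContDiff ℝ ∞ β ∧ Continuous g ∧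
      PeriodicFst β ∧ (∀ b, β (Real.pi, b) = 0) ∧ β (0, y) = A * δ ∧
      (∀ k q, coeff g k q = -(eigenvalue k q * coeff β k q)) ∧
      ∫ x in cell, g x ^ 2 ≤ E ∧ ∫ x in cell, β x ^ 2 ≤ D * δ ^ 2 := by
  obtain ⟨C, hC0, hC⟩ := exists_cutoff_bound
  have hpi := Real.pi_pos
  refine ⟨(2 * |A| * C ^ 2) ^ 2 * (4 * Real.pi), (|A| * C ^ 2) ^ 2 * (4 * Real.pi), by positivity,
    by positivity, fun δ y hδ hδ1 hy1 hy2 => ?_⟩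
  set a : ℝ → ℝ := fun x => A * δ * cutoff (Real.sin (x / 2) / δ) with ha
  set a' : ℝ → ℝ := fun x =>
    A * δ * (deriv cutoff (Real.sin (x / 2) / δ) * (Real.cos (x / 2) / (2 * δ))) with ha'
  set a'' : ℝ → ℝ := fun x =>
    A * δ * (deriv (deriv cutoff) (Real.sin (x / 2) / δ) * (Real.cos (x / 2) / (2 * δ)) ^ 2
      - deriv cutoff (Real.sin (x / 2) / δ) * (Real.sin (x / 2) / (4 * δ))) with ha''
  set b : ℝ → ℝ := fun z => cutoff ((z - y) / δ) with hb
  set b' : ℝ → ℝ := fun z => deriv cutoff ((z - y) / δ) * (1 / δ) with hb'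
  set b'' : ℝ → ℝ := fun z => deriv (deriv cutoff) ((z - y) / δ) * (1 / δ) * (1 / δ) with hb''
  have hhalf : ∀ x : ℝ, HasDerivAt (fun x : ℝ => x / 2) (1 / 2 : ℝ) x :=
    fun x => (hasDerivAt_id x).div_const 2
  have hsin : ∀ x : ℝ,
      HasDerivAt (fun x => Real.sin (x / 2) / δ) (Real.cos (x / 2) / (2 * δ)) x := fun x =>
    ((hhalf x).sin.div_const δ).congr_deriv (by field_simp)
  have hcos : ∀ x : ℝ,
      HasDerivAt (fun x => Real.cos (x / 2) / (2 * δ)) (-(Real.sin (x / 2) / (4 * δ))) x :=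
    fun x => ((hhalf x).cos.div_const (2 * δ)).congr_deriv (by field_simp; ring)
  have hlin : ∀ z : ℝ, HasDerivAt (fun z => (z - y) / δ) (1 / δ) z := fun z =>
    ((hasDerivAt_id z).sub_const y).div_const δ
  have da : ∀ x, HasDerivAt a (a' x) x := fun x =>
    ((hasDerivAt_cutoff _).comp x (hsin x)).const_mul (A * δ)
  have da' : ∀ x, HasDerivAt a' (a'' x) x := fun x =>
    ((((hasDerivAt_deriv_cutoff _).comp x (hsin x)).fun_mul (hcos x)).const_mul
      (A * δ)).congr_deriv (by simp only [ha'', Function.comp]; ring)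
  have db : ∀ z, HasDerivAt b (b' z) z := fun z => (hasDerivAt_cutoff _).comp z (hlin z)
  have db' : ∀ z, HasDerivAt b' (b'' z) z := fun z =>
    ((hasDerivAt_deriv_cutoff _).comp z (hlin z)).mul_const (1 / δ)
  have cd1 := contDiff_deriv_cutoff.continuous
  have cd2 := continuous_deriv_deriv_cutoff
  have ca'' : Continuous a'' := by simp only [ha'']; fun_prop
  have cb'' : Continuous b'' := by simp only [hb'']; fun_prop
  have ca : Continuous a := continuous_iff_continuousAt.2 fun x => (da x).continuousAt
  have cb : Continuous b := continuous_iff_continuousAt.2 fun x => (db x).continuousAt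
  have out1 : ∀ {x : ℝ}, 1 < |x| → deriv cutoff x = 0 :=
    deriv_eq_zero_outside fun x hx => cutoff_of_one_le hx.le
  have out2 : ∀ {x : ℝ}, 1 < |x| → deriv (deriv cutoff) x = 0 :=
    deriv_eq_zero_outside fun x hx => out1 hx
  -- `|sin (x / 2)| ≥ |x| / π` on `[-π, π]`
  have hjordan : ∀ x ∈ Icc (-Real.pi) Real.pi, x ∉ Icc (-(Real.pi * δ)) (Real.pi * δ) →
      1 < |Real.sin (x / 2) / δ| := by
    intro x hx hxn
    have h1 : Real.pi * δ < |x| := by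
      by_contra! h
      exact hxn (abs_le.1 h)
    have h2 := Real.mul_abs_le_abs_sin (x := x / 2) (by
      rw [abs_div, abs_two]
      linarith [abs_le.2 hx])
    rw [abs_div, abs_of_pos hδ, lt_div_iff₀ hδ, one_mul]
    refine lt_of_lt_of_le ?_ h2
    rw [abs_div, abs_two]
    field_simp
    linarith
  have houtb : ∀ z, z ∉ Icc (y - δ) (y + δ) → 1 < |(z - y) / δ| := by
    intro z hz
    rw [abs_div, abs_of_pos hδ, lt_div_iff₀ hδ, one_mul]
    by_contra! h
    exact hz ⟨by linarith [(abs_le.1 h).1], by linarith [(abs_le.1 h).2]⟩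
  have ba : ∀ x, |a x| ≤ |A| * C := fun x => by
    simp only [ha, abs_mul, abs_of_pos hδ]
    calc |A| * δ * |cutoff (Real.sin (x / 2) / δ)| ≤ |A| * 1 * C := by
          gcongr
          exact (hC _).1
      _ = |A| * C := by ring
  have ba_delta : ∀ x, |a x| ≤ |A| * δ * C := fun x => by
    simp only [ha, abs_mul, abs_of_pos hδ]
    gcongr
    exact (hC _).1
  have ba'' : ∀ x, |a'' x| ≤ |A| * C / δ := fun x => by
    have hs := Real.abs_sin_le_one (x / 2)
    have hc := Real.abs_cos_le_one (x / 2)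
    simp only [ha'', abs_mul, abs_of_pos hδ]
    calc _ ≤ |A| * δ * (C * (1 / (2 * δ)) ^ 2 + C * (1 / (4 * δ))) := by
          gcongr
          refine (abs_sub _ _).trans (add_le_add ?_ ?_)
          · rw [abs_mul, abs_pow, abs_div, abs_of_pos (by positivity : 0 < 2 * δ)]
            gcongr
            exact (hC _).2.2
          · rw [abs_mul, abs_div, abs_of_pos (by positivity : 0 < 4 * δ)]
            gcongr
            exact (hC _).2.1
      _ = |A| * C / δ * ((1 + δ) / 4) := by field_simp; ring
      _ ≤ |A| * C / δ * 1 := by gcongr; linarith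
      _ = |A| * C / δ := mul_one _
  have bb : ∀ z, |b z| ≤ C := fun z => (hC _).1
  have bb'' : ∀ z, |b'' z| ≤ C / δ ^ 2 := fun z => by
    simp only [hb'', abs_mul, abs_of_pos (by positivity : 0 < 1 / δ)]
    calc _ ≤ C * (1 / δ) * (1 / δ) := by gcongr; exact (hC _).2.2
      _ = C / δ ^ 2 := by field_simp
  have bsin : ∀ x, Real.sin ((x + 2 * Real.pi) / 2) = -Real.sin (x / 2) := fun x => by
    rw [show (x + 2 * Real.pi) / 2 = x / 2 + Real.pi by ring, Real.sin_add_pi]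
  have hδinv : 1 ≤ 1 / δ := by rw [le_div_iff₀ hδ]; linarith
  have za : a Real.pi = 0 := by
    simp only [ha]
    rw [Real.sin_pi_div_two, cutoff_of_one_le (by rwa [abs_of_pos (by positivity)]), mul_zero]
  have za2 : a (-Real.pi) = 0 := by
    simp only [ha]
    rw [neg_div, Real.sin_neg, Real.sin_pi_div_two, neg_div, cutoff_neg,
      cutoff_of_one_le (by rwa [abs_of_pos (by positivity)]), mul_zero]
  have zb : b Real.pi = 0 := by
    refine cutoff_of_one_le ?_
    rwa [abs_div, abs_of_pos hδ, le_div_iff₀ hδ, one_mul]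
  have zb2 : b (-Real.pi) = 0 := by
    refine cutoff_of_one_le ?_
    rwa [abs_div, abs_of_pos hδ, le_div_iff₀ hδ, one_mul]
  refine ⟨fun x => a x.1 * b x.2, fun x => a'' x.1 * b x.2 + a x.1 * b'' x.2, ?_, by fun_prop, ?_,
    fun z => by simp [za], ?_, ?_, ?_, ?_⟩
  · have cc := contDiff_cutoff
    simp only [ha, hb]
    exact (contDiff_const.mul (cc.comp (by fun_prop))).mul (cc.comp (by fun_prop))
  · intro x _
    simp only [ha]
    rw [bsin, neg_div, cutoff_neg]
  · simp [ha, hb, cutoff_zero]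
  · refine fun k q => coeff_laplacian da da' ca'' db db' cb'' (by rw [za, za2]) ?_ zb zb2 k q
    simp [ha', neg_div, Real.cos_pi_div_two]
  · refine (setIntegral_sq_le_of_support (by fun_prop) (B := 2 * |A| * C ^ 2 / δ) (y := y) hδ.le
      (fun x => ?_) fun x hx hxQ => ?_).trans_eq (by field_simp)
    · calc |a'' x.1 * b x.2 + a x.1 * b'' x.2|
          ≤ |a'' x.1| * |b x.2| + |a x.1| * |b'' x.2| := by
            rw [← abs_mul, ← abs_mul]; exact abs_add_le _ _
        _ ≤ |A| * C / δ * C + |A| * δ * C * (C / δ ^ 2) := by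
            gcongr
            exacts [ba'' _, bb _, ba_delta _, bb'' _]
        _ = 2 * |A| * C ^ 2 / δ := by field_simp; ring
    · by_cases h1 : x.1 ∈ Icc (-(Real.pi * δ)) (Real.pi * δ)
      · have h2 := houtb x.2 fun h => hxQ ⟨h1, h⟩
        simp only [hb, hb'']
        rw [cutoff_of_one_le h2.le, out2 h2]
        ring
      · have h2 := hjordan x.1 hx.1 h1
        simp only [ha, ha'']
        rw [cutoff_of_one_le h2.le, out2 h2, out1 h2]
        ring
  · refine (setIntegral_sq_le_of_support (by fun_prop) (B := |A| * C ^ 2) (y := y) hδ.le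
      (fun x => ?_) fun x hx hxQ => ?_).trans_eq (by ring)
    · rw [abs_mul]
      calc |a x.1| * |b x.2| ≤ |A| * C * C := by
            gcongr
            exacts [ba _, bb _]
        _ = _ := by ring
    · by_cases h1 : x.1 ∈ Icc (-(Real.pi * δ)) (Real.pi * δ)
      · have h2 := houtb x.2 fun h => hxQ ⟨h1, h⟩
        simp only [hb]
        rw [cutoff_of_one_le h2.le, mul_zero]
      · have h2 := hjordan x.1 hx.1 h1
        simp only [ha]
        rw [cutoff_of_one_le h2.le]
        ring

/-! ### Instability -/

/-- Arbitrarily close to a stationary density there is a density with a bubble: it exceeds somewhere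
a level `M` that it does not exceed on the vertical line `x₁ = π`. -/
lemma IsStationarySolution.exists_perturbation {ρs : ℝ × ℝ → ℝ} (hs : IsStationarySolution ρs)
    {ε γ : ℝ} (hε : 0 < ε) (hγ : 0 < γ) :
    ∃ ρ₀ : ℝ × ℝ → ℝ, ∃ M : ℝ, SmoothOnStrip ρ₀ ∧
      sobolevNorm (2 - γ) (fun x => ρ₀ x - ρs x) ≤ ENNReal.ofReal ε ∧
      (∀ y ∈ Icc (-Real.pi) Real.pi, ρ₀ (Real.pi, y) ≤ M) ∧ ∃ x ∈ cell, M < ρ₀ x := by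
  have hpi := Real.pi_gt_three
  have hsm := hs.smoothOnStrip
  have hprof : ContDiffOn ℝ ∞ (fun y => ρs (0, y)) (Icc (-Real.pi) Real.pi) :=
    hsm.smooth.comp (f := fun y : ℝ => ((0 : ℝ), y)) (by fun_prop) fun y hy => mk_mem_strip hy
  obtain ⟨K, hK⟩ := hprof.exists_lipschitzOnWith (by simp) (convex_Icc _ _) isCompact_Icc
  obtain ⟨y₀, hy₀, hmax⟩ := isCompact_Icc.exists_isMaxOn
    (nonempty_Icc.2 neg_pi_lt_pi.le) hprof.continuousOn
  -- the slope `2 K + 1` makes up for the loss of `ρs` at distance `2 δ` from its maximum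
  obtain ⟨E, D, hE, hD, hbump⟩ := exists_bump (2 * K + 1)
  set κ := ε ^ 2 / (2 * (E + 1)) with hκ
  obtain ⟨C, hC, hpow⟩ := exists_rpow_le hγ (κ := κ) (by positivity)
  obtain ⟨δ, hδ, hδ1, hδ2⟩ : ∃ δ : ℝ, 0 < δ ∧ δ ≤ 1 ∧ (C + 1) * D * δ ^ 2 ≤ ε ^ 2 / 2 := by
    have hlim : Tendsto (fun δ : ℝ => (C + 1) * D * δ ^ 2) (nhdsWithin 0 (Ioi 0)) (nhds 0) := by
      have : Continuous fun δ : ℝ => (C + 1) * D * δ ^ 2 := by fun_prop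
      simpa using (this.tendsto 0).mono_left nhdsWithin_le_nhds
    have h1 := hlim.eventually (ge_mem_nhds (show 0 < ε ^ 2 / 2 by positivity))
    have h2 : ∀ᶠ δ : ℝ in nhdsWithin 0 (Ioi 0), δ ∈ Ioc (0 : ℝ) 1 :=
      Ioc_mem_nhdsGT one_pos
    obtain ⟨δ, h1, h2⟩ := (h1.and h2).exists
    exact ⟨δ, h2.1, h2.2, h1⟩
  -- move away from the maximum towards the middle of the strip
  obtain ⟨y, hy, hdist, hw1, hw2⟩ : ∃ y ∈ Icc (-Real.pi) Real.pi, |y - y₀| = 2 * δ ∧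
      δ ≤ |Real.pi - y| ∧ δ ≤ |-Real.pi - y| := by
    rcases le_total y₀ 0 with h | h
    · refine ⟨y₀ + 2 * δ, ⟨by linarith [hy₀.1], by linarith⟩, ?_, ?_, ?_⟩
      · rw [add_sub_cancel_left, abs_of_pos (by positivity)]
      · exact le_trans (by linarith) (le_abs_self _)
      · exact le_trans (by linarith [hy₀.1]) (neg_le_abs _)
    · refine ⟨y₀ - 2 * δ, ⟨by linarith, by linarith [hy₀.2]⟩, ?_, ?_, ?_⟩
      · rw [sub_sub_cancel_left, abs_neg, abs_of_pos (by positivity)]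
      · exact le_trans (by linarith [hy₀.2]) (le_abs_self _)
      · exact le_trans (by linarith) (neg_le_abs _)
  obtain ⟨β, g, hβ, cg, pβ, zβ, vβ, hg, ig, iβ⟩ := hbump δ y hδ hδ1 hw1 hw2
  refine ⟨fun x => ρs x + β x, ρs (0, y₀), ⟨hsm.smooth.add hβ.contDiffOn, fun x hx => ?_⟩, ?_,
    fun z hz => ?_, (0, y), ⟨⟨by linarith, by linarith⟩, hy⟩, ?_⟩
  · rw [hsm.periodic x hx, pβ x hx]
  · simp only [add_sub_cancel_left]
    refine sobolevNorm_le hβ.continuous cg hg hC (by positivity) hpow hε.le ?_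
    have h1 : κ * (∫ x in cell, g x ^ 2) ≤ ε ^ 2 / 2 := by
      calc κ * (∫ x in cell, g x ^ 2) ≤ κ * (E + 1) := by gcongr; linarith
        _ = ε ^ 2 / 2 := by rw [hκ]; field_simp
    have h2 : (C + 1) * (∫ x in cell, β x ^ 2) ≤ (C + 1) * (D * δ ^ 2) := by gcongr
    linarith
  · change ρs (Real.pi, z) + β (Real.pi, z) ≤ ρs (0, y₀)
    rw [zβ, add_zero, hs.eq_of_mem_strip Real.pi hz]
    exact hmax hz
  · have h1 := hK.dist_le_mul y hy y₀ hy₀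
    rw [Real.dist_eq, Real.dist_eq, hdist] at h1
    have h2 := (abs_le.1 h1).1
    change ρs (0, y₀) < ρs (0, y) + β (0, y)
    rw [vβ]
    linarith

/-- A bubble keeps the horizontal derivative of the density away from zero for all times. -/
lemma IsGlobalSmoothSolution.exists_lower_bound {ρ : ℝ → ℝ × ℝ → ℝ} {u : ℝ → ℝ × ℝ → ℝ × ℝ}
    {p : ℝ → ℝ × ℝ → ℝ} (h : IsGlobalSmoothSolution ρ u p) {M : ℝ}
    (hM : ∀ y ∈ Icc (-Real.pi) Real.pi, ρ 0 (Real.pi, y) ≤ M) (hx : ∃ x ∈ cell, M < ρ 0 x) :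
    ∃ m, 0 < m ∧ ∀ t, 0 ≤ t → m ≤ ∫ x in cell, d1 (ρ t) x ^ 2 := by
  have c0 := (h.contDiffOn_density le_rfl).continuousOn.mono cell_subset_strip
  have hpos : 0 < ∫ x in cell, (max (ρ 0 x - M) 0) ^ 2 := by
    refine lt_of_le_of_ne (integral_nonneg fun _ => sq_nonneg _) fun h0 => ?_
    obtain ⟨x, hx, hlt⟩ := hx
    have := eqOn_zero_of_setIntegral_cell_eq_zero (f := fun x => (max (ρ 0 x - M) 0) ^ 2)
      (by fun_prop) (fun _ => sq_nonneg _) h0.symm x hx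
    rw [max_eq_left (by linarith), pow_eq_zero_iff two_ne_zero] at this
    linarith
  have hpi := Real.pi_pos
  refine ⟨(∫ x in cell, (max (ρ 0 x - M) 0) ^ 2) / (2 * Real.pi) ^ 2, by positivity,
    fun t ht => ?_⟩
  rw [div_le_iff₀' (by positivity), ← h.setIntegral_conserved (F := fun r => (max (r - M) 0) ^ 2)
    (F' := fun r => 2 * max (r - M) 0) (hasDerivAt_posPart_sq M) (by fun_prop) ht]
  refine setIntegral_excess_le (h.smoothOnStrip ht) fun b hb => ?_
  obtain ⟨a, y, hy, e⟩ := h.exists_density_eq_initial ht hb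
  exact ⟨a, e.trans_le (hM y hy)⟩

/-- The dissipation is integrable in time, so it cannot be bounded below by `c / t`. -/
lemma IsGlobalSmoothSolution.not_dissipation_ge {ρ : ℝ → ℝ × ℝ → ℝ} {u : ℝ → ℝ × ℝ → ℝ × ℝ}
    {p : ℝ → ℝ × ℝ → ℝ} (h : IsGlobalSmoothSolution ρ u p) {c T : ℝ} (hc : 0 < c) (hT : 0 < T)
    (hdiss : ∀ t, T ≤ t → c * t⁻¹ ≤ ∫ x in cell, ((u t x).1 ^ 2 + (u t x).2 ^ 2)) : False := by
  obtain ⟨B, hB⟩ := h.potential_energy_bounded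
  have hlog : ∀ S, T ≤ S → c * (Real.log (S / T)) ≤ 2 * B := by
    intro S hS
    have hsub : Icc T S ×ˢ cell ⊆ Ici 0 ×ˢ strip :=
      prod_mono (fun τ hτ => hT.le.trans hτ.1) cell_subset_strip
    have ck : ContinuousOn (fun z : ℝ × (ℝ × ℝ) => (u z.1 z.2).1 ^ 2 + (u z.1 z.2).2 ^ 2)
        (Icc T S ×ˢ cell) := by
      have := h.smooth_velocity.continuousOn.mono hsub
      fun_prop
    have cU := continuousOn_setIntegral_cell (k := fun τ x => (u τ x).1 ^ 2 + (u τ x).2 ^ 2)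
      isCompact_Icc ck
    have cinv : ContinuousOn (fun τ : ℝ => c * τ⁻¹) (Icc T S) :=
      continuousOn_const.mul (continuousOn_id.inv₀ fun τ hτ => (hT.trans_le hτ.1).ne')
    have hle : ∫ τ in Icc T S, c * τ⁻¹ ≤
        ∫ τ in Icc T S, ∫ x in cell, ((u τ x).1 ^ 2 + (u τ x).2 ^ 2) :=
      setIntegral_mono_on (cinv.integrableOn_compact isCompact_Icc)
        (cU.integrableOn_compact isCompact_Icc) measurableSet_Icc fun τ hτ => hdiss τ hτ.1
    rw [integral_const_mul, integral_Icc_eq_integral_Ioc, ← intervalIntegral.integral_of_le hS,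
      integral_inv_of_pos hT (hT.trans_le hS)] at hle
    have hE := h.potential_energy_sub hT.le hS
    have h1 := (abs_le.1 (hB S (hT.le.trans hS))).1
    have h2 := (abs_le.1 (hB T hT.le)).2
    linarith
  have hlim : Tendsto (fun S => c * Real.log (S / T)) atTop atTop :=
    (Real.tendsto_log_atTop.comp (tendsto_id.atTop_div_const hT)).const_mul_atTop hc
  obtain ⟨S, hS1, hS2⟩ := ((hlim.eventually_gt_atTop (2 * B)).and (eventually_ge_atTop T)).exists
  exact absurd (hlog S hS2) (not_le.2 hS1)

/-- Growth of all norms above `Ḣ¹`, for solutions whose horizontal derivative stays away from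
zero. -/
lemma IsGlobalSmoothSolution.limsup_eq_top {ρ : ℝ → ℝ × ℝ → ℝ} {u : ℝ → ℝ × ℝ → ℝ × ℝ}
    {p : ℝ → ℝ × ℝ → ℝ} (h : IsGlobalSmoothSolution ρ u p) {ρs : ℝ × ℝ → ℝ}
    (hs : IsStationarySolution ρs) {m : ℝ} (hm : 0 < m)
    (hlow : ∀ t, 0 ≤ t → m ≤ ∫ x in cell, d1 (ρ t) x ^ 2) {s : ℝ} (hs0 : 0 < s) :
    limsup (fun t : ℝ => ENNReal.ofReal (t ^ (-(s / 2)))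
      * homSobolevNorm (s + 1) (fun x => ρ t x - ρs x)) atTop = ⊤ := by
  by_contra hne
  obtain ⟨C, hC1, hC2⟩ := exists_between (lt_top_iff_ne_top.2 hne)
  have hev := eventually_lt_of_limsup_lt hC1
  lift C to NNReal using hC2.ne
  -- with `R = K t` the high norm contributes at most `m / 2` to the interpolation inequality
  obtain ⟨K, hK0, hK⟩ : ∃ K : ℝ, 0 < K ∧ K ^ (-s) * (C : ℝ) ^ 2 ≤ m / 2 := by
    have hlim : Tendsto (fun K : ℝ => K ^ (-s) * (C : ℝ) ^ 2) atTop (nhds 0) := by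
      simpa using (tendsto_rpow_neg_atTop hs0).mul_const ((C : ℝ) ^ 2)
    obtain ⟨K, h1, h2⟩ := ((hlim.eventually (ge_mem_nhds (half_pos hm))).and
      (eventually_gt_atTop 0)).exists
    exact ⟨K, h2, h1⟩
  obtain ⟨T, hT⟩ := (hev.and (eventually_gt_atTop 0)).exists_forall_of_atTop
  have hTpos : 0 < T := (hT T le_rfl).2
  refine h.not_dissipation_ge (c := m / (2 * K)) (T := T) (by positivity) hTpos fun t ht => ?_
  have ht0 : 0 < t := hTpos.trans_le ht
  set N := homSobolevNorm (s + 1) (fun x => ρ t x - ρs x) with hN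
  set U := ∫ x in cell, ((u t x).1 ^ 2 + (u t x).2 ^ 2) with hU
  have hU0 : 0 ≤ U := integral_nonneg fun _ => by positivity
  have hint := h.interpolation hs ht0.le hs0 (R := K * t) (by positivity)
  have hhigh : ENNReal.ofReal ((K * t) ^ (-s)) * N ^ 2 ≤ ENNReal.ofReal (m / 2) := by
    have h1 : (ENNReal.ofReal (t ^ (-(s / 2))) * N) ^ 2 ≤ ENNReal.ofReal ((C : ℝ) ^ 2) := by
      rw [ENNReal.ofReal_pow C.coe_nonneg, ENNReal.ofReal_coe_nnreal]
      gcongr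
      exact (hT t ht).1.le
    have h2 : (t ^ (-(s / 2))) ^ 2 = t ^ (-s) := by
      rw [← Real.rpow_natCast, ← Real.rpow_mul ht0.le]
      congr 1
      push_cast
      ring
    rw [mul_pow, ← ENNReal.ofReal_pow (by positivity), h2] at h1
    rw [Real.mul_rpow hK0.le ht0.le, ENNReal.ofReal_mul (by positivity), mul_assoc]
    refine (mul_le_mul_right h1 _).trans ?_
    rw [← ENNReal.ofReal_mul (by positivity)]
    exact ENNReal.ofReal_le_ofReal hK
  have hfin := (ENNReal.ofReal_le_ofReal (hlow t ht0.le)).trans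
    (hint.trans (add_le_add_right hhigh _))
  rw [← ENNReal.ofReal_add (by positivity) (by positivity),
    ENNReal.ofReal_le_ofReal_iff (by positivity)] at hfin
  have : m / 2 ≤ K * t * U := by linarith
  calc m / (2 * K) * t⁻¹ = m / 2 / (K * t) := by field_simp
    _ ≤ U := by rw [div_le_iff₀' (by positivity)]; exact this

end IPM

end

theorem theorem1p5 (ρs : ℝ × ℝ → ℝ) (hρs : IPM.IsStationarySolution ρs)
    (ε γ : ℝ) (hε : 0 < ε) (hγ : 0 < γ) :
    ∃ ρ₀ : ℝ × ℝ → ℝ, IPM.SmoothOnStrip ρ₀ ∧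
      IPM.sobolevNorm (2 - γ) (fun x => ρ₀ x - ρs x) ≤ ENNReal.ofReal ε ∧
      ∀ (ρ : ℝ → ℝ × ℝ → ℝ) (u : ℝ → ℝ × ℝ → ℝ × ℝ) (p : ℝ → ℝ × ℝ → ℝ),
        IPM.IsGlobalSmoothSolution ρ u p → (∀ x ∈ IPM.strip, ρ 0 x = ρ₀ x) →
          ∀ s : ℝ, 0 < s →
            limsup (fun t : ℝ => ENNReal.ofReal (t ^ (-(s / 2)))
              * IPM.homSobolevNorm (s + 1) (fun x => ρ t x - ρs x)) atTop = ⊤ := by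
  obtain ⟨ρ₀, M, hsm, hnorm, hM, x, hx, hlt⟩ := hρs.exists_perturbation hε hγ
  refine ⟨ρ₀, hsm, hnorm, fun ρ u p h h0 s hs => ?_⟩
  obtain ⟨m, hm, hlow⟩ := h.exists_lower_bound (M := M)
    (fun y hy => (h0 _ (IPM.mk_mem_strip hy)).trans_le (hM y hy))
    ⟨x, hx, hlt.trans_eq (h0 x (IPM.cell_subset_strip hx)).symm⟩
  exact h.limsup_eq_top hρs hm hlow hs
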